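/- **Setting.** Let $d,q$ be natural numbers and let $\mathcal P$ be the set of distributions of $(X,Y,Z)$ on $[0,1]\times[0,1]\times[0,1]^d$ that are absolutely continuous with respect to Lebesgue measure. Let $\mathcal H\subset\mathcal P$ be the set of those under which $X$ and $Y$ are conditionally independent given $Z$. Let $\mathcal P_0\subset\mathcal P$ and $\mathcal H_0=\mathcal P_0\cap\mathcal H$. For each $P\in\mathcal P_0$ fix versions of the conditional distributions of $X$ given $Z$ and of $Y$ given $Z$, with conditional distribution functions $F_{X\mid Z}(t\mid z)=P(X\le t\mid Z=z)$, $F_{Y\mid Z}(t\mid z)=P(Y\le t\mid Z=z)$ and conditional quantile functions $Q_{X\mid Z}(\tau\mid z)=\inf\{t\in[0,1]: F_{X\mid Z}(t\mid z)\ge\tau\}$, and similarly $Q_{Y\mid Z}$. Let $\phi=(\phi_1,\dots,\phi_q):[0,1]\to\mathbb R^q$ have linearly independent Lipschitz coordinates such that the support $\mathcal T_k$ of $\phi_k$ is a compact subset of $(0,1)$, $\int_0^1\phi_k(u)\,du=0$ and $\int_0^1\phi_k(u)^2\,du=1$ for every $k$. Put $\tau_{\min}=\inf\bigcup_k\mathcal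 T_k$, $\tau_{\max}=\sup\bigcup_k\mathcal T_k$, and for $f:[0,1]\times[0,1]^d\to\mathbb R$ let $$\|f\|_{\mathcal T,\infty}=\sup_{z}\ \sup_{t\in[Q_{X\mid Z}(\tau_{\min}\mid z),\,Q_{X\mid Z}(\tau_{\max}\mid z)]}|f(t,z)|,\qquad \|f\|_{\mathcal T^c,\infty}=\sup_{z}\ \sup_{t\in[0,1]\setminus[Q_{X\mid Z}(\tau_{\min}\mid z),\,Q_{X\mid Z}(\tau_{\max}\mid z)]}|f(t,z)|,$$ and let $\|\cdot\|'_{\mathcal T,\infty}$, $\|\cdot\|'_{\mathcal T^c,\infty}$ be the same with $Q_{Y\mid Z}$ in place of $Q_{X\mid Z}$. Let $(X_i,Y_i,Z_i)_{i=1}^n$ be an i.i.d. sample from $P$. Let $\hat F^{(n)}_{X\mid Z}$ be an estimator that is a measurable function of $(X_i,Z_i)_{i=1}^n$ only, and $\hat F^{(n)}_{Y\mid Z}$ one that is a measurable function of $(Y_i,Z_i)_{i=1}^n$ only, such that for every $z\in[0,1]^d$ the functions $t\mapsto\hat F^{(n)}_{X\mid Z}(t\mid z)$ and $t\mapsto\hat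 F^{(n)}_{Y\mid Z}(t\mid z)$ are continuous and increasing on $[0,1]$ with value $0$ at $t=0$ and $1$ at $t=1$. With $\hat U_{1,i}=\hat F^{(n)}_{X\mid Z}(X_i\mid Z_i)$, $\hat U_{2,i}=\hat F^{(n)}_{Y\mid Z}(Y_i\mid Z_i)$, $U_1=F_{X\mid Z}(X\mid Z)$ and $U_2=F_{Y\mid Z}(Y\mid Z)$ let $$\hat\rho_n=\frac1n\sum_{i=1}^n\phi(\hat U_{1,i})\phi(\hat U_{2,i})^T,\qquad \rho=\rho_P=E_P\big(\phi(U_1)\phi(U_2)^T\big),\qquad \Sigma_{k,s}=\int_0^1\phi_k(u)\phi_s(u)\,du .$$ For a set $\mathcal M$ of distributions and a deterministic sequence $(a_n)$ write $X_n\in\mathcal O_{\mathcal M}(a_n)$ if for every $\epsilon>0$ there is $M>0$ with $\sup_{n\ge1}\sup_{P\in\mathcal M}P(|X_n|>M|a_n|)<\epsilon$. Write $X_n\to_{\mathcal M}c_P$ if $\sup_{P\in\mathcal M}P(\|X_n-c_P\|>\epsilon)\to0$ for every $\epsilon>0$. Write $X_n\Rightarrow_{\mathcal M}\nu$ if $\sup_{P\in\mathcal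 M}|E_P f(X_n)-\int f\,d\nu|\to0$ for every bounded continuous $f$. **Theorem.** Suppose that $g(n)\to0$ and $h(n)\to0$ are deterministic rate functions such that - $\|F_{X\mid Z}-\hat F^{(n)}_{X\mid Z}\|_{\mathcal T,\infty}\in\mathcal O_{\mathcal P_0}(g(n))$ and $\|F_{Y\mid Z}-\hat F^{(n)}_{Y\mid Z}\|'_{\mathcal T,\infty}\in\mathcal O_{\mathcal P_0}(h(n))$; - $\|\xi-\hat F^{(n)}_{X\mid Z}\|_{\mathcal T^c,\infty}\in\mathcal O_{\mathcal P_0}(g(n))$ and $\|\xi'-\hat F^{(n)}_{Y\mid Z}\|'_{\mathcal T^c,\infty}\in\mathcal O_{\mathcal P_0}(h(n))$ for some functions $\xi=\xi_P,\ \xi'=\xi'_P:[0,1]\times[0,1]^d\to\mathbb R$, which may depend on $P$. Then: (i) if $\sqrt n\,g(n)h(n)\to0$, then $\sqrt n\,\hat\rho_n\Rightarrow_{\mathcal H_0}\mathcal N(0,\Sigma\otimes\Sigma)$, where $q\times q$ matrices are regarded as vectors indexed by pairs $(k,\ell)$ and $(\Sigma\otimes\Sigma)_{k\ell,st}=\Sigma_{ks}\Sigma_{\ell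 t}$; (ii) $\hat\rho_n\to_{\mathcal P_0}\rho$. -/

import Mathlib

open MeasureTheory ProbabilityTheory Filter Topology Set
open scoped unitInterval Kronecker ENNReal BoundedContinuousFunction

noncomputable section

namespace PartialCopula

/-- The unit cube `[0, 1]^d`. -/
abbrev Cube (d : ℕ) : Type := Fin d → I

/-- The observation space `[0, 1]^(2 + d)`; a point is a triple `(x, y, z)`. -/
abbrev Obs (d : ℕ) : Type := I × I × Cube d

/-- The coordinate `X`. -/
def obsX {d : ℕ} (w : Obs d) : I := w.1

/-- The coordinate `Y`. -/
def obsY {d : ℕ} (w : Obs d) : I := w.2.1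

/-- The coordinate `Z`. -/
def obsZ {d : ℕ} (w : Obs d) : Cube d := w.2.2

theorem measurable_obsZ {d : ℕ} : Measurable (obsZ : Obs d → Cube d) :=
  measurable_snd.comp measurable_snd

/-- The distributions on `[0, 1]^(2 + d)` that are absolutely continuous with respect to Lebesgue
measure. -/
def acDistributions (d : ℕ) : Set (ProbabilityMeasure (Obs d)) :=
  {P | (P : Measure (Obs d)) ≪ volume}

/-- The absolutely continuous distributions under which `X` and `Y` are conditionally independent
given `Z`. -/
def condIndepDistributions (d : ℕ) : Set (ProbabilityMeasure (Obs d)) :=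
  {P | P ∈ acDistributions d ∧
    CondIndepFun (MeasurableSpace.comap (obsZ : Obs d → Cube d) inferInstance)
      measurable_obsZ.comap_le obsX obsY (P : Measure (Obs d))}

/-- `κ` is a version of the conditional distribution of the `[0, 1]`-valued variable `V` given `Z`
under `P`. -/
def IsCondDistrib {d : ℕ} (P : ProbabilityMeasure (Obs d)) (V : Obs d → I)
    (κ : Kernel (Cube d) I) : Prop :=
  ((P : Measure (Obs d)).map (fun w => (obsZ w, V w))).IsCondKernel κ

/-- The conditional distribution function `F(t | z) = κ(z, [0, t])`, with values in `[0, 1]`. -/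
def condCDF {d : ℕ} (κ : Kernel (Cube d) I) [IsMarkovKernel κ] (t : I) (z : Cube d) : I :=
  ⟨(κ z).real (Iic t), measureReal_nonneg, measureReal_le_one⟩

/-- The conditional quantile function `Q(τ | z) = inf {t ∈ [0, 1] | F(t | z) ≥ τ}`. -/
def condQuantile {d : ℕ} (κ : Kernel (Cube d) I) [IsMarkovKernel κ] (τ : ℝ) (z : Cube d) : ℝ :=
  sInf ((fun t : I => (t : ℝ)) '' {t : I | τ ≤ (condCDF κ t z : ℝ)})

/-- An estimator of a conditional distribution function: for every sample size `n` a (measurable)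
map from a sample `(V_i, Z_i)_{i < n}` of the pair (response, covariate) to a function
`(t, z) ↦ F̂(t | z)` such that every `F̂(· | z)` is continuous and increasing from `0` to `1`. -/
structure CDFEstimator (d : ℕ) where
  est : (n : ℕ) → (Fin n → I × Cube d) → I → Cube d → I
  measurable_est : ∀ n, Measurable
    (fun p : (Fin n → I × Cube d) × I × Cube d => est n p.1 p.2.1 p.2.2)
  continuous_est : ∀ n s z, Continuous (fun t => est n s t z)
  monotone_est : ∀ n s z, Monotone (fun t => est n s t z)
  est_zero : ∀ n s z, est n s 0 z = 0
  est_one : ∀ n s z, est n s 1 z = 1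

/-- `F̂_{X|Z}`: the estimator applied to the sample `(X_i, Z_i)`. -/
def estX {d : ℕ} (F : CDFEstimator d) (n : ℕ) (w : Fin n → Obs d) : I → Cube d → I :=
  F.est n (fun i => (obsX (w i), obsZ (w i)))

/-- `F̂_{Y|Z}`: the estimator applied to the sample `(Y_i, Z_i)`. -/
def estY {d : ℕ} (F : CDFEstimator d) (n : ℕ) (w : Fin n → Obs d) : I → Cube d → I :=
  F.est n (fun i => (obsY (w i), obsZ (w i)))

/-- The standing assumptions on `φ = (φ_1, …, φ_q) : [0, 1] → ℝ^q`. The support `tsupport (φ k)` is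
closed in `[0, 1]`, hence automatically compact. -/
structure Admissible {q : ℕ} (φ : Fin q → I → ℝ) : Prop where
  support_subset : ∀ k, tsupport (φ k) ⊆ Ioo 0 1
  lipschitz : ∀ k, ∃ L, LipschitzWith L (φ k)
  integral_eq_zero : ∀ k, ∫ u, φ k u = 0
  integral_sq_eq_one : ∀ k, ∫ u, φ k u ^ 2 = 1
  linearIndependent : LinearIndependent ℝ φ

/-- `τ_min`, the infimum of the union of the supports. -/
def tauMin {q : ℕ} (φ : Fin q → I → ℝ) : ℝ :=
  sInf ((fun u : I => (u : ℝ)) '' ⋃ k, tsupport (φ k))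

/-- `τ_max`, the supremum of the union of the supports. -/
def tauMax {q : ℕ} (φ : Fin q → I → ℝ) : ℝ :=
  sSup ((fun u : I => (u : ℝ)) '' ⋃ k, tsupport (φ k))

/-- `Q(𝒯 | z) = [Q(τ_min | z), Q(τ_max | z)]`, as a subset of `[0, 1]`. -/
def quantileRange {d q : ℕ} (φ : Fin q → I → ℝ) (κ : Kernel (Cube d) I) [IsMarkovKernel κ]
    (z : Cube d) : Set I :=
  {t | (t : ℝ) ∈ Icc (condQuantile κ (tauMin φ) z) (condQuantile κ (tauMax φ) z)}

/-- `‖f‖_{𝒯,∞} = sup_z sup_{t ∈ Q(𝒯 | z)} |f(t, z)|`, with values in `[0, ∞]`. -/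
def innerNorm {d q : ℕ} (φ : Fin q → I → ℝ) (κ : Kernel (Cube d) I) [IsMarkovKernel κ]
    (f : I → Cube d → ℝ) : ℝ≥0∞ :=
  ⨆ z, ⨆ t ∈ quantileRange φ κ z, ENNReal.ofReal |f t z|

/-- `‖f‖_{𝒯ᶜ,∞}`: the same supremum over the complement of `Q(𝒯 | z)` in `[0, 1]`. -/
def outerNorm {d q : ℕ} (φ : Fin q → I → ℝ) (κ : Kernel (Cube d) I) [IsMarkovKernel κ]
    (f : I → Cube d → ℝ) : ℝ≥0∞ :=
  ⨆ z, ⨆ t ∈ (quantileRange φ κ z)ᶜ, ENNReal.ofReal |f t z|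

/-- The law of an i.i.d. sample of size `n` from `P`. -/
def sampleLaw {d : ℕ} (P : ProbabilityMeasure (Obs d)) (n : ℕ) : Measure (Fin n → Obs d) :=
  Measure.pi (fun _ => (P : Measure (Obs d)))

/-- `X_n ∈ 𝒪_ℳ(a_n)`: big-O in probability, uniformly over `ℳ`. The statistic `X P n` may depend
on `P`, and has values in `[0, ∞]`; `|X_n / a_n| > M` is written `X_n > M |a_n|`. -/
def UniformBigO {d : ℕ} (ℳ : Set (ProbabilityMeasure (Obs d)))
    (X : ProbabilityMeasure (Obs d) → (n : ℕ) → (Fin n → Obs d) → ℝ≥0∞) (a : ℕ → ℝ) : Prop :=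
  ∀ ε : ℝ, 0 < ε → ∃ M : ℝ, 0 < M ∧
    (⨆ n ≥ 1, ⨆ P ∈ ℳ, sampleLaw P n {w | ENNReal.ofReal (M * |a n|) < X P n w}) <
      ENNReal.ofReal ε

/-- Uniform convergence in distribution over `ℳ` of the statistics `X n` to the fixed law `ν`. -/
def UniformTendstoInDistribution {d : ℕ} {E : Type*} [TopologicalSpace E] [MeasurableSpace E]
    (ℳ : Set (ProbabilityMeasure (Obs d))) (X : (n : ℕ) → (Fin n → Obs d) → E)
    (ν : Measure E) : Prop :=
  ∀ f : E →ᵇ ℝ, Tendsto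
    (fun n : ℕ => ⨆ P ∈ ℳ, ENNReal.ofReal |(∫ w, f (X n w) ∂(sampleLaw P n)) - ∫ x, f x ∂ν|)
    atTop (𝓝 0)

/-- Uniform convergence in probability over `ℳ` of the statistics `X n` to the constants `c P`. -/
def UniformTendstoInProbability {d : ℕ} {E : Type*} [NormedAddCommGroup E]
    (ℳ : Set (ProbabilityMeasure (Obs d))) (X : (n : ℕ) → (Fin n → Obs d) → E)
    (c : ProbabilityMeasure (Obs d) → E) : Prop :=
  ∀ ε : ℝ, 0 < ε → Tendsto
    (fun n : ℕ => ⨆ P ∈ ℳ, sampleLaw P n {w | ε < ‖X n w - c P‖}) atTop (𝓝 0)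

/-- The uniform consistency assumption with rate functions `g` and `h`. The tail limits `ξ`, `ξ'`
may depend on `P`. -/
structure UniformlyConsistent {d q : ℕ} (φ : Fin q → I → ℝ)
    (P₀ : Set (ProbabilityMeasure (Obs d)))
    (κX κY : ProbabilityMeasure (Obs d) → Kernel (Cube d) I)
    [∀ P, IsMarkovKernel (κX P)] [∀ P, IsMarkovKernel (κY P)]
    (FX FY : CDFEstimator d) (g h : ℕ → ℝ) : Prop where
  g_tendsto : Tendsto g atTop (𝓝 0)
  h_tendsto : Tendsto h atTop (𝓝 0)
  inner_X : UniformBigO P₀ (fun P n w => innerNorm φ (κX P)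
    (fun t z => (condCDF (κX P) t z : ℝ) - (estX FX n w t z : ℝ))) g
  inner_Y : UniformBigO P₀ (fun P n w => innerNorm φ (κY P)
    (fun t z => (condCDF (κY P) t z : ℝ) - (estY FY n w t z : ℝ))) h
  outer_X : ∃ ξ : ProbabilityMeasure (Obs d) → I → Cube d → ℝ,
    UniformBigO P₀ (fun P n w => outerNorm φ (κX P)
      (fun t z => ξ P t z - (estX FX n w t z : ℝ))) g
  outer_Y : ∃ ξ' : ProbabilityMeasure (Obs d) → I → Cube d → ℝ,
    UniformBigO P₀ (fun P n w => outerNorm φ (κY P)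
      (fun t z => ξ' P t z - (estY FY n w t z : ℝ))) h

/-- The generalized correlation `ρ = E_P(φ(U₁) φ(U₂)ᵀ)`, where `U₁ = F_{X|Z}(X | Z)` and
`U₂ = F_{Y|Z}(Y | Z)`; `q × q` matrices are regarded as vectors indexed by pairs `(k, ℓ)`. -/
def rho {d q : ℕ} (φ : Fin q → I → ℝ) (P : ProbabilityMeasure (Obs d))
    (κX κY : Kernel (Cube d) I) [IsMarkovKernel κX] [IsMarkovKernel κY] :
    EuclideanSpace ℝ (Fin q × Fin q) :=
  WithLp.toLp 2 fun kl => ∫ w, φ kl.1 (condCDF κX (obsX w) (obsZ w)) *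
    φ kl.2 (condCDF κY (obsY w) (obsZ w)) ∂(P : Measure (Obs d))

/-- The test statistic `ρ̂_n = n⁻¹ ∑ φ(Û_{1,i}) φ(Û_{2,i})ᵀ`, where
`Û_{1,i} = F̂_{X|Z}(X_i | Z_i)` and `Û_{2,i} = F̂_{Y|Z}(Y_i | Z_i)`. -/
def rhoHat {d q : ℕ} (φ : Fin q → I → ℝ) (FX FY : CDFEstimator d) (n : ℕ) (w : Fin n → Obs d) :
    EuclideanSpace ℝ (Fin q × Fin q) :=
  WithLp.toLp 2 fun kl => (1 / (n : ℝ)) * ∑ i, φ kl.1 (estX FX n w (obsX (w i)) (obsZ (w i))) *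
    φ kl.2 (estY FY n w (obsY (w i)) (obsZ (w i)))

/-- The matrix `Σ_{k,s} = ∫₀¹ φ_k(u) φ_s(u) du`. -/
def gram {q : ℕ} (φ : Fin q → I → ℝ) : Matrix (Fin q) (Fin q) ℝ :=
  Matrix.of fun k s => ∫ u, φ k u * φ s u

end PartialCopula

end

open PartialCopula

/-! A supremum over a class of laws tends to zero as soon as it does along every sequence `P n` in
the class (`tendsto_biSup_of_forall_seq`). Both claims thus become pointwise limit theorems for
triangular arrays whose law changes with `n`.

Fix coordinates k, l and let A_i = φ_k(Û_{1,i}) - φ_k(U_{1,i}) and B_i = φ_l(Û_{2,i}) -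
φ_l(U_{2,i}). Since φ is Lipschitz and vanishes outside [τ_min, τ_max], and F̂ is monotone, the sup
error of F̂ on the quantile range bounds A_i and B_i up to a constant, even when an observation
falls outside that range (`Admissible.abs_sub_le`). Now expand φ_k(Û₁)φ_l(Û₂) = φ_k(U₁)φ_l(U₂) + A
φ_l(U₂) + B φ_k(U₁) + A B.

For (ii), the means of the error terms are at most a constant times the means of |A| and |B|, which
vanish, and a weak law for arrays treats the first term.

For (i), everything is multiplied by √n. The A B term is of order √n g h. The term A φ_l(U₂) needs
no rate: A depends only on the (X, Z) data, and given these the φ_l(U_{2,i}) are centered and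
uncorrelated, because U₂ is uniform given Z and ∫ φ_l = 0. Hence its second moment is at most a
constant times the expected mean of A², which tends to 0 (`ArrayBigO.vanishesInProb_cross`); the
other cross term is symmetric. In the oracle term (U₁, U₂) is uniform on the square whatever the law
in the null class (`map_ranks_eq`), so the classical central limit theorem for one fixed law
applies, and Fubini gives the covariance Σ ⊗ Σ. The pieces are joined through characteristic
functions and Lévy's continuity theorem. -/

namespace PartialCopula

/-! ### Convergence to zero in probability on varying probability spaces. -/

section VanishesInProb

/-- The real statistics `R n`, each defined on its own measure space, tend to zero in
probability. -/
def VanishesInProb {Ω : ℕ → Type*} [∀ n, MeasurableSpace (Ω n)] (μ : ∀ n, Measure (Ω n))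
    (R : ∀ n, Ω n → ℝ) : Prop :=
  ∀ ε : ℝ, 0 < ε → Tendsto (fun n => μ n {w | ε < |R n w|}) atTop (𝓝 0)

variable {Ω : ℕ → Type*} [∀ n, MeasurableSpace (Ω n)] {μ : ∀ n, Measure (Ω n)}
  {R S : ∀ n, Ω n → ℝ}

theorem tendsto_measure_zero_of_subset {s t : ∀ n, Set (Ω n)}
    (ht : Tendsto (fun n => μ n (t n)) atTop (𝓝 0)) (h : ∀ n, s n ⊆ t n) :
    Tendsto (fun n => μ n (s n)) atTop (𝓝 0) :=
  tendsto_of_tendsto_of_tendsto_of_le_of_le tendsto_const_nhds ht (fun _ => zero_le)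
    fun n => measure_mono (h n)

theorem tendsto_measure_union_zero {s t : ∀ n, Set (Ω n)}
    (hs : Tendsto (fun n => μ n (s n)) atTop (𝓝 0))
    (ht : Tendsto (fun n => μ n (t n)) atTop (𝓝 0)) :
    Tendsto (fun n => μ n (s n ∪ t n)) atTop (𝓝 0) := by
  refine tendsto_of_tendsto_of_tendsto_of_le_of_le tendsto_const_nhds ?_ (fun _ => zero_le)
    fun n => measure_union_le _ _
  simpa using hs.add ht

theorem VanishesInProb.mono_of_eventually (hR : VanishesInProb μ R)
    (h : ∀ᶠ n in atTop, ∀ w, |S n w| ≤ |R n w|) : VanishesInProb μ S := fun ε hε =>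
  tendsto_of_tendsto_of_tendsto_of_le_of_le' tendsto_const_nhds (hR ε hε)
    (Eventually.of_forall fun _ => zero_le)
    (h.mono fun _ hn => measure_mono fun w hw => lt_of_lt_of_le hw (hn w))

theorem VanishesInProb.mono (hR : VanishesInProb μ R) (h : ∀ n w, |S n w| ≤ |R n w|) :
    VanishesInProb μ S :=
  hR.mono_of_eventually (Eventually.of_forall h)

theorem VanishesInProb.zero : VanishesInProb μ (fun _ _ => 0) := fun ε hε => by
  simp [hε.not_gt]

theorem VanishesInProb.add (hR : VanishesInProb μ R) (hS : VanishesInProb μ S) :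
    VanishesInProb μ (fun n w => R n w + S n w) := fun ε hε =>
  tendsto_measure_zero_of_subset
    (tendsto_measure_union_zero (hR _ (half_pos hε)) (hS _ (half_pos hε))) fun n w hw => by
      by_contra! hcon
      simp only [mem_union, mem_ofPred_eq, not_or, not_lt] at hcon hw
      linarith [abs_add_le (R n w) (S n w)]

theorem VanishesInProb.abs (hR : VanishesInProb μ R) : VanishesInProb μ (fun n w => |R n w|) :=
  hR.mono fun _ _ => (abs_abs _).le

theorem VanishesInProb.const_mul (hR : VanishesInProb μ R) (c : ℝ) :
    VanishesInProb μ (fun n w => c * R n w) := fun ε hε => by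
  have hc : 0 < |c| + 1 := by positivity
  refine tendsto_measure_zero_of_subset (hR _ (div_pos hε hc)) fun n w hw => ?_
  simp only [mem_ofPred_eq, abs_mul] at hw ⊢
  rw [div_lt_iff₀ hc]
  nlinarith [abs_nonneg (R n w)]

theorem VanishesInProb.sum {ι : Type*} (s : Finset ι) {R : ι → ∀ n, Ω n → ℝ}
    (hR : ∀ i ∈ s, VanishesInProb μ (R i)) :
    VanishesInProb μ (fun n w => ∑ i ∈ s, R i n w) := by
  classical
  induction s using Finset.induction_on with
  | empty => simpa using VanishesInProb.zero
  | insert a s ha ih =>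
    simp only [Finset.sum_insert ha]
    exact (hR a (Finset.mem_insert_self a s)).add
      (ih fun i hi => hR i (Finset.mem_insert_of_mem hi))

variable [∀ n, IsProbabilityMeasure (μ n)]

/-- Bounded convergence when the probability space changes with `n`: splitting at level ε gives ∫
|R| ≤ ε + K μ{|R| > ε}. -/
theorem VanishesInProb.tendsto_integral (hR : VanishesInProb μ R) (hm : ∀ n, Measurable (R n))
    {K : ℝ} (hK : ∀ n w, |R n w| ≤ K) :
    Tendsto (fun n => ∫ w, |R n w| ∂(μ n)) atTop (𝓝 0) := by
  have key : ∀ ε : ℝ, 0 < ε → ∀ n,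
      ∫ w, |R n w| ∂(μ n) ≤ ε + K * (μ n).real {w | ε < |R n w|} := by
    intro ε hε n
    have hs : MeasurableSet {w | ε < |R n w|} :=
      measurableSet_lt measurable_const (hm n).abs
    have hi : Integrable ({w | ε < |R n w|}.indicator fun _ => K) (μ n) :=
      (integrable_const K).indicator hs
    calc ∫ w, |R n w| ∂(μ n)
        ≤ ∫ w, (ε + {w | ε < |R n w|}.indicator (fun _ => K) w) ∂(μ n) := by
          refine integral_mono (.of_bound (hm n).abs.aestronglyMeasurable K ?_)
            ((integrable_const ε).add hi) fun w => ?_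
          · exact ae_of_all _ fun w => by simpa using hK n w
          · by_cases hw : ε < |R n w|
            · rw [indicator_of_mem (show w ∈ {w | ε < |R n w|} from hw)]
              linarith [hK n w]
            · rw [indicator_of_notMem (show w ∉ {w | ε < |R n w|} from hw)]
              linarith
      _ = ε + K * (μ n).real {w | ε < |R n w|} := by
          rw [integral_add (integrable_const ε) hi, integral_indicator_const _ hs]
          simp [mul_comm]
  rw [Metric.tendsto_atTop]
  intro ε hε
  have h1 : Tendsto (fun n => K * (μ n).real {w | ε / 2 < |R n w|}) atTop (𝓝 (K * 0)) :=
    (((ENNReal.tendsto_toReal ENNReal.zero_ne_top).comp (hR _ (half_pos hε)))).const_mul K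
  rw [mul_zero] at h1
  obtain ⟨N, hN⟩ := eventually_atTop.1 (h1.eventually_lt_const (half_pos hε))
  refine ⟨N, fun n hn => ?_⟩
  have h2 : 0 ≤ ∫ w, |R n w| ∂(μ n) := integral_nonneg fun w => abs_nonneg _
  rw [Real.dist_eq, sub_zero, abs_of_nonneg h2]
  linarith [key _ (half_pos hε) n, hN n hn]

/-- Chebyshev's inequality. -/
theorem vanishesInProb_of_tendsto_integral_sq (hi : ∀ n, Integrable (fun w => R n w ^ 2) (μ n))
    (h : Tendsto (fun n => ∫ w, R n w ^ 2 ∂(μ n)) atTop (𝓝 0)) : VanishesInProb μ R := by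
  intro ε hε
  have hε2 : 0 < ε ^ 2 := by positivity
  rw [← ENNReal.tendsto_toReal_iff (fun n => measure_ne_top _ _) ENNReal.zero_ne_top]
  have h0 : Tendsto (fun n => (∫ w, R n w ^ 2 ∂(μ n)) / ε ^ 2) atTop (𝓝 0) := by
    simpa using h.div_const (ε ^ 2)
  refine squeeze_zero (fun n => ENNReal.toReal_nonneg) (fun n => ?_) h0
  rw [le_div_iff₀ hε2, mul_comm]
  refine le_trans ?_ (mul_meas_ge_le_integral_of_nonneg (ae_of_all _ fun w => sq_nonneg _)
    (hi n) (ε ^ 2))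
  refine mul_le_mul_of_nonneg_left (measureReal_mono fun w hw => ?_) hε2.le
  simp only [mem_ofPred_eq] at hw ⊢
  rw [← sq_abs (R n w)]
  exact pow_le_pow_left₀ hε.le hw.le 2

theorem norm_cexp_mul_I_sub_le (a b : ℝ) :
    ‖Complex.exp (a * Complex.I) - Complex.exp (b * Complex.I)‖ ≤ |a - b| := by
  have h : Complex.exp (a * Complex.I) - Complex.exp (b * Complex.I) =
      Complex.exp (b * Complex.I) * (Complex.exp (Complex.I * ((a - b : ℝ) : ℂ)) - 1) := by
    rw [mul_sub, ← Complex.exp_add, mul_one]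
    push_cast
    ring_nf
  rw [h, norm_mul, Complex.norm_exp_ofReal_mul_I, one_mul]
  simpa using Real.norm_exp_I_mul_ofReal_sub_one_le (x := a - b)

/-- Slutsky's lemma for characteristic functions: s ↦ exp(is) is 1-Lipschitz, so the exponentials
differ by a quantity that is bounded by 2 and vanishes in probability, hence in mean. -/
theorem VanishesInProb.tendsto_charFun {E : Type*} [NormedAddCommGroup E] [InnerProductSpace ℝ E]
    [MeasurableSpace E] [BorelSpace E] [SecondCountableTopology E] {X : ∀ n, Ω n → E}
    {T : ∀ n, Ω n → ℝ} (hX : ∀ n, Measurable (X n)) (hT : ∀ n, Measurable (T n)) (t : E)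
    (h : VanishesInProb μ fun n w => inner ℝ (X n w) t - T n w) :
    Tendsto (fun n => charFun ((μ n).map (X n)) t -
      ∫ w, Complex.exp (T n w * Complex.I) ∂(μ n)) atTop (𝓝 0) := by
  have hin : ∀ n, Measurable fun w => inner ℝ (X n w) t := fun n => (hX n).inner_const
  have hv : VanishesInProb μ fun n w => ‖Complex.exp (((inner ℝ (X n w) t : ℝ) : ℂ) * Complex.I) -
      Complex.exp (T n w * Complex.I)‖ :=
    h.mono fun n w => by
      rw [abs_of_nonneg (norm_nonneg _)]
      exact norm_cexp_mul_I_sub_le _ _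
  have h2 := hv.tendsto_integral (fun n => by have := hin n; have := hT n; fun_prop) (K := 2)
    fun n w => by
      rw [abs_of_nonneg (norm_nonneg _)]
      refine (norm_sub_le _ _).trans ?_
      rw [Complex.norm_exp_ofReal_mul_I, Complex.norm_exp_ofReal_mul_I]
      norm_num
  refine squeeze_zero_norm (fun n => ?_) h2
  have i1 : ∀ f : Ω n → ℝ, Measurable f →
      Integrable (fun w => Complex.exp (f w * Complex.I)) (μ n) := fun f hf =>
    .of_bound (by fun_prop) 1 (ae_of_all _ fun w => by rw [Complex.norm_exp_ofReal_mul_I])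
  rw [charFun_apply, integral_map (hX n).aemeasurable (by fun_prop),
    ← integral_sub (i1 _ (hin n)) (i1 _ (hT n))]
  refine (norm_integral_le_integral_norm _).trans (le_of_eq ?_)
  simp

end VanishesInProb

/-! ### Reduction of uniformity to sequences of laws. -/

/-- If the supremum exceeded ε infinitely often, choosing a violating element at each such index
would give a sequence contradicting the hypothesis. -/
theorem tendsto_biSup_of_forall_seq {α : Type*} {s : Set α} {a : ℕ → α → ℝ≥0∞}
    (h : ∀ P : ℕ → α, (∀ n, P n ∈ s) → Tendsto (fun n => a n (P n)) atTop (𝓝 0)) :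
    Tendsto (fun n => ⨆ P ∈ s, a n P) atTop (𝓝 0) := by
  classical
  rw [ENNReal.tendsto_nhds_zero]
  intro ε hε
  by_contra hcon
  obtain ⟨n₀, hn₀⟩ := (not_eventually.1 hcon).exists
  have hex : ∀ n, ¬ (⨆ P ∈ s, a n P) ≤ ε → ∃ P ∈ s, ε < a n P := fun n hn => by
    simpa using hn
  -- A failure at one index shows that `s` is nonempty; `P₀` fills the indices where nothing
  -- violates the bound.
  obtain ⟨P₀, hP₀, -⟩ := hex n₀ hn₀
  let P : ℕ → α := fun n => if hn : ∃ P ∈ s, ε < a n P then hn.choose else P₀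
  have hP : ∀ n, P n ∈ s := fun n => by
    by_cases hn : ∃ P ∈ s, ε < a n P
    · simpa [P, hn] using hn.choose_spec.1
    · simpa [P, hn] using hP₀
  obtain ⟨n, hn, hle⟩ :=
    ((not_eventually.1 hcon).and_eventually (ENNReal.tendsto_nhds_zero.1 (h P hP) ε hε)).exists
  have hn' := hex n hn
  have h3 : ε < a n (P n) := by simpa [P, hn'] using hn'.choose_spec.2
  exact absurd hle (not_le.2 h3)

/-! ### Second moments of sums weighted by functions of the whole partial sample. -/

section SecondMoment

variable {Ω α : Type*} [MeasurableSpace Ω] [MeasurableSpace α]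

/-- With all coordinates but the i-th frozen, `ψ (w j)` is a constant and `H` is a bounded function
of `π (w i)`, so integrating over `w i` already gives 0 by `hψ`. -/
theorem integral_pi_mul_eq_zero (μ : Measure Ω) [IsProbabilityMeasure μ] {π : Ω → α}
    (hπ : Measurable π) {ψ : Ω → ℝ} (hψm : Measurable ψ) {K : ℝ} (hK : ∀ w, |ψ w| ≤ K)
    (hψ : ∀ G : α → ℝ, Measurable G → (∃ c, ∀ a, |G a| ≤ c) → ∫ w, G (π w) * ψ w ∂μ = 0)
    {n : ℕ} {H : (Fin n → α) → ℝ} (hHm : Measurable H) {c : ℝ} (hH : ∀ v, |H v| ≤ c)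
    {i j : Fin n} (hij : i ≠ j) :
    ∫ w, H (fun m => π (w m)) * ψ (w i) * ψ (w j) ∂(Measure.pi fun _ : Fin n => μ) = 0 := by
  obtain _ | n := n
  · exact i.elim0
  obtain ⟨j, rfl⟩ := Fin.exists_succAbove_eq hij.symm
  have hmp := measurePreserving_piFinSuccAbove (fun _ : Fin (n + 1) => μ) i
  rw [← hmp.symm.integral_comp' (g := fun w : Fin (n + 1) → Ω =>
    H (fun m => π (w m)) * ψ (w i) * ψ (w (i.succAbove j)))]
  have hins : ∀ p : Ω × (Fin n → Ω),
      (MeasurableEquiv.piFinSuccAbove (fun _ : Fin (n + 1) => Ω) i).symm p =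
        i.insertNth p.1 p.2 := fun p => rfl
  have hcomp : ∀ p : Ω × (Fin n → Ω),
      (fun m => π ((i.insertNth p.1 p.2 : Fin (n + 1) → Ω) m)) =
        (i.insertNth (π p.1) (fun m => π (p.2 m)) : Fin (n + 1) → α) := fun p => by
    funext m
    refine Fin.succAboveCases i ?_ (fun k => ?_) m <;> simp
  simp only [hins, hcomp, Fin.insertNth_apply_same, Fin.insertNth_apply_succAbove]
  have hinsm : Measurable fun p : α × (Fin n → α) =>
      (i.insertNth p.1 p.2 : Fin (n + 1) → α) :=
    (MeasurableEquiv.piFinSuccAbove (fun _ : Fin (n + 1) => α) i).symm.measurable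
  have hmeas : Measurable fun p : Ω × (Fin n → Ω) =>
      H (i.insertNth (π p.1) (fun m => π (p.2 m))) := hHm.comp (hinsm.comp ((hπ.comp measurable_fst).prodMk
      (measurable_pi_lambda _ fun m => hπ.comp ((measurable_pi_apply m).comp measurable_snd))))
  have hc : 0 ≤ c := (abs_nonneg _).trans (hH (fun m => π (Classical.choice
    (nonempty_of_isProbabilityMeasure μ))))
  have hK0 : 0 ≤ K := (abs_nonneg _).trans (hK (Classical.choice
    (nonempty_of_isProbabilityMeasure μ)))
  -- The singled-out coordinate must be integrated first, with the others held fixed.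
  rw [integral_prod_symm]
  · refine integral_eq_zero_of_ae (ae_of_all _ fun w' => ?_)
    simp only [Pi.zero_apply]
    rw [integral_mul_const, hψ (fun a => H (i.insertNth a (fun m => π (w' m))))
      (hHm.comp (hinsm.comp measurable_prodMk_right)) ⟨c, fun a => hH _⟩, zero_mul]
  · refine .of_bound (by fun_prop) (c * K * K) (ae_of_all _ fun p => ?_)
    rw [Real.norm_eq_abs, abs_mul, abs_mul]
    gcongr
    exacts [hH _, hK _, hK _]

/-- In the expanded square the off-diagonal terms integrate to 0, although every weight may depend
on the entire `π`-sample; on the diagonal ψ² ≤ K². -/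
theorem integral_sq_sum_mul_le (μ : Measure Ω) [IsProbabilityMeasure μ] {π : Ω → α}
    (hπ : Measurable π) {ψ : Ω → ℝ} (hψm : Measurable ψ) {K : ℝ} (hK : ∀ w, |ψ w| ≤ K)
    (hψ : ∀ G : α → ℝ, Measurable G → (∃ c, ∀ a, |G a| ≤ c) → ∫ w, G (π w) * ψ w ∂μ = 0)
    {n : ℕ} {D : (Fin n → α) → Fin n → ℝ} (hDm : ∀ i, Measurable fun v => D v i) {c : ℝ}
    (hD : ∀ v i, |D v i| ≤ c) :
    ∫ w, (∑ i, D (fun m => π (w m)) i * ψ (w i)) ^ 2 ∂(Measure.pi fun _ : Fin n => μ) ≤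
      K ^ 2 * ∫ w, ∑ i, D (fun m => π (w m)) i ^ 2 ∂(Measure.pi fun _ : Fin n => μ) := by
  have hDm' : ∀ i, Measurable fun w : Fin n → Ω => D (fun m => π (w m)) i := fun i =>
    (hDm i).comp (by fun_prop)
  have hDi : ∀ i, Integrable (fun w : Fin n → Ω => D (fun m => π (w m)) i ^ 2)
      (Measure.pi fun _ : Fin n => μ) := fun i => by
    refine .of_bound ((hDm' i).pow_const 2).aestronglyMeasurable (c ^ 2) (ae_of_all _ fun w => ?_)
    rw [Real.norm_eq_abs, abs_pow]
    exact pow_le_pow_left₀ (abs_nonneg _) (hD _ _) 2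
  have hK0 : 0 ≤ K := (abs_nonneg _).trans (hK (Classical.choice
    (nonempty_of_isProbabilityMeasure μ)))
  have hi : ∀ i j, Integrable (fun w : Fin n → Ω => D (fun m => π (w m)) i *
      D (fun m => π (w m)) j * ψ (w i) * ψ (w j)) (Measure.pi fun _ : Fin n => μ) := fun i j => by
    have := hDm' i
    have := hDm' j
    have hc : 0 ≤ c := (abs_nonneg _).trans (hD (fun m => π (Classical.choice
      (nonempty_of_isProbabilityMeasure μ))) i)
    refine .of_bound (by fun_prop) (c * c * K * K) (ae_of_all _ fun w => ?_)
    rw [Real.norm_eq_abs, abs_mul, abs_mul, abs_mul]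
    gcongr
    exacts [hD _ _, hD _ _, hK _, hK _]
  have hexp : ∀ w : Fin n → Ω, (∑ i, D (fun m => π (w m)) i * ψ (w i)) ^ 2 =
      ∑ i, ∑ j, D (fun m => π (w m)) i * D (fun m => π (w m)) j * ψ (w i) * ψ (w j) := fun w => by
    rw [sq, Finset.sum_mul_sum]
    exact Finset.sum_congr rfl fun i _ => Finset.sum_congr rfl fun j _ => by ring
  simp only [hexp]
  rw [integral_finsetSum _ fun i _ => integrable_finsetSum _ fun j _ => hi i j,
    integral_finsetSum _ fun i _ => hDi i, Finset.mul_sum]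
  refine Finset.sum_le_sum fun i _ => ?_
  rw [integral_finsetSum _ fun j _ => hi i j, Finset.sum_eq_single i]
  · rw [← integral_const_mul]
    refine integral_mono (hi i i) ((hDi i).const_mul _) fun w => ?_
    have h1 : ψ (w i) ^ 2 ≤ K ^ 2 := by
      rw [← sq_abs]
      exact pow_le_pow_left₀ (abs_nonneg _) (hK _) 2
    calc D (fun m => π (w m)) i * D (fun m => π (w m)) i * ψ (w i) * ψ (w i)
        = ψ (w i) ^ 2 * D (fun m => π (w m)) i ^ 2 := by ring
      _ ≤ K ^ 2 * D (fun m => π (w m)) i ^ 2 := by gcongr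
  · intro j _ hj
    exact integral_pi_mul_eq_zero μ hπ hψm hK hψ
      (H := fun v => D v i * D v j) ((hDm i).mul (hDm j)) (c := c * c)
      (fun v => by
        rw [abs_mul]
        exact mul_le_mul (hD _ _) (hD _ _) (abs_nonneg _) ((abs_nonneg _).trans (hD v i))) hj.symm
  · simp

end SecondMoment

/-- The central limit theorem for normalized i.i.d. sums, as convergence of characteristic
functions at `1`, with the variance allowed to vanish. -/
theorem tendsto_integral_cexp_sum {E : Type*} [MeasurableSpace E] (ν : Measure E)
    [IsProbabilityMeasure ν] {ψ : E → ℝ} (hm : Measurable ψ) (hi : Integrable (fun u => ψ u ^ 2) ν)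
    (h0 : ∫ u, ψ u ∂ν = 0) :
    Tendsto (fun n : ℕ => (∫ u, Complex.exp (((√n)⁻¹ * ψ u : ℝ) * Complex.I) ∂ν) ^ n) atTop
      (𝓝 (Complex.exp (-((∫ u, ψ u ^ 2 ∂ν : ℝ) : ℂ) / 2))) := by
  set v := ∫ u, ψ u ^ 2 ∂ν with hv
  have hv0 : 0 ≤ v := integral_nonneg fun u => sq_nonneg _
  obtain hv1 | hv1 := hv0.eq_or_lt
  -- Zero variance cannot be normalized away; there ψ = 0 almost everywhere and both sides equal 1.
  · have hz : ψ =ᵐ[ν] 0 := by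
      have := (integral_eq_zero_iff_of_nonneg (fun u => sq_nonneg (ψ u)) hi).1 hv1.symm
      filter_upwards [this] with u hu
      simpa using hu
    have h1 : ∀ n : ℕ, ∫ u, Complex.exp (((√n)⁻¹ * ψ u : ℝ) * Complex.I) ∂ν = 1 := fun n => by
      rw [integral_congr_ae (g := fun _ => (1 : ℂ)) (by
        filter_upwards [hz] with u hu
        simp [hu])]
      simp
    simp only [h1, one_pow, ← hv1]
    simp
  · have hs : √v ≠ 0 := (Real.sqrt_pos.2 hv1).ne'
    -- The standardized variable ψ / √v is evaluated at frequency √v, which restores ψ at frequency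
    -- 1.
    have h := tendsto_charFun_inv_sqrt_mul_pow (P := ν) (X := fun u => ψ u / √v)
      (hm.div_const _).aemeasurable (by simp [integral_div, h0])
      (by
        simp only [Pi.pow_apply, div_pow, Real.sq_sqrt hv0]
        rw [integral_div, ← hv, div_self hv1.ne']) (√v)
    convert h using 2 with n
    · congr 1
      rw [charFun_apply_real, integral_map (hm.div_const _).aemeasurable (by fun_prop)]
      refine integral_congr_ae (ae_of_all _ fun u => ?_)
      simp only
      congr 2
      push_cast
      have : ((√v : ℝ) : ℂ) ≠ 0 := by exact_mod_cast hs
      field_simp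
    · rw [← Complex.ofReal_pow, Real.sq_sqrt hv0]

/-! ### Measurability of the coordinates and of the conditional distribution function. -/

section Measurability

theorem measurable_obsX {d : ℕ} : Measurable (obsX : Obs d → I) := measurable_fst

theorem measurable_obsY {d : ℕ} : Measurable (obsY : Obs d → I) :=
  measurable_fst.comp measurable_snd

theorem measurable_condCDF {d : ℕ} (κ : Kernel (Cube d) I) [IsMarkovKernel κ] :
    Measurable fun p : I × Cube d => condCDF κ p.1 p.2 := by
  have h : Measurable fun p : I × Cube d =>
      (Kernel.comap κ Prod.snd measurable_snd) p (Prod.mk p ⁻¹' {r : (I × Cube d) × I | r.2 ≤ r.1.1}) :=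
    Kernel.measurable_kernel_prodMk_left
      (measurableSet_le measurable_snd (measurable_fst.comp measurable_fst))
  exact Measurable.subtype_mk h.ennreal_toReal

end Measurability

/-! ### Atomless conditional laws and the probability integral transform. -/

section CondCDF

variable {d : ℕ} {κ : Kernel (Cube d) I} [IsMarkovKernel κ] {z : Cube d}

/-- The set of pairs (z, t) with t an atom of `κ z` has countable sections, so it is Lebesgue null
by Fubini, hence null for the law of (Z, V). Disintegrating, almost every `κ z` gives its own set of
atoms mass 0, so that set is empty. -/
theorem ae_forall_measure_singleton_eq_zero {P : ProbabilityMeasure (Obs d)}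
    (hP : P ∈ acDistributions d) {V : Obs d → I}
    (hV : MeasurePreserving (fun w : Obs d => (obsZ w, V w)) volume volume)
    (hκ : IsCondDistrib P V κ) :
    ∀ᵐ z ∂((P : Measure (Obs d)).map obsZ), ∀ t, κ z {t} = 0 := by
  have hVm : Measurable V := measurable_snd.comp hV.measurable
  have hfst : ((P : Measure (Obs d)).map fun w => (obsZ w, V w)).fst =
      (P : Measure (Obs d)).map obsZ := Measure.fst_map_prodMk hVm
  have hdis := hκ.disintegrate
  rw [hfst] at hdis
  have hac : (P : Measure (Obs d)).map (fun w => (obsZ w, V w)) ≪ volume := by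
    have h := (show (P : Measure (Obs d)) ≪ volume from hP).map hV.measurable
    rwa [hV.map_eq] at h
  have hm : Measurable fun p : Cube d × I => κ p.1 {p.2} := by
    have h : Measurable fun p : Cube d × I =>
        (Kernel.comap κ Prod.fst measurable_fst) p
          (Prod.mk p ⁻¹' {r : (Cube d × I) × I | r.2 = r.1.2}) :=
      Kernel.measurable_kernel_prodMk_left
        (measurableSet_eq_fun measurable_snd (measurable_snd.comp measurable_fst))
    exact h
  let A : Set (Cube d × I) := {p | κ p.1 {p.2} = 0}ᶜ
  have hA : MeasurableSet A := (hm (measurableSet_singleton 0)).compl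
  have hcount : ∀ z, (Prod.mk z ⁻¹' A).Countable := fun z => by
    have h := Measure.countable_meas_pos_of_disjoint_iUnion (μ := κ z) (As := fun t : I => {t})
      (fun t => measurableSet_singleton t) (fun s t hst => by simpa using hst)
    refine h.mono fun t ht => ?_
    exact pos_iff_ne_zero.2 ht
  have hvol : (volume : Measure (Cube d × I)) A = 0 := by
    rw [Measure.volume_eq_prod, Measure.prod_apply hA]
    simp [fun z => (hcount z).measure_zero volume]
  have h0 := hac hvol
  rw [← hdis, Measure.compProd_apply hA, lintegral_eq_zero_iff
    (Kernel.measurable_kernel_prodMk_left hA)] at h0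
  filter_upwards [h0] with z hz t
  by_contra ht
  refine ht (measure_mono_null (singleton_subset_iff.2 ?_) hz)
  exact ht

theorem condCDF_mono : Monotone fun t => condCDF κ t z := fun _ _ hst =>
  measureReal_mono (Iic_subset_Iic.2 hst)

theorem condCDF_one : condCDF κ 1 z = 1 := by
  apply Subtype.ext
  have : Iic (1 : I) = univ := eq_univ_of_forall fun t => unitInterval.le_one'
  simp [condCDF, this]

theorem condCDF_zero (hz : ∀ t, κ z {t} = 0) : condCDF κ 0 z = 0 := by
  apply Subtype.ext
  have : Iic (0 : I) = {0} := by
    ext t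
    simp
  simp [condCDF, this, measureReal_def, hz]

theorem continuous_condCDF (hz : ∀ t, κ z {t} = 0) : Continuous fun t => condCDF κ t z := by
  refine Continuous.subtype_mk (continuous_iff_continuousAt.2 fun a => ?_) _
  have hF : ∀ t, (κ z).real (Iic t) = ∫ s, (Iic t).indicator (fun _ => (1 : ℝ)) s ∂(κ z) :=
    fun t => by rw [integral_indicator_const _ measurableSet_Iic]; simp
  simp only [hF]
  refine continuousAt_of_dominated (bound := fun _ => 1)
    (Eventually.of_forall fun t =>
      (measurable_const.indicator measurableSet_Iic).aestronglyMeasurable)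
    (Eventually.of_forall fun t => ae_of_all _ fun s => ?_) (integrable_const _) ?_
  · by_cases hs : s ∈ Iic t <;> simp [hs]
  · have hne : ∀ᵐ s ∂(κ z), s ≠ a := by
      simpa [ae_iff] using hz a
    filter_upwards [hne] with s hs
    obtain hlt | hlt := lt_or_gt_of_ne hs
    · refine (continuousAt_const (y := (1 : ℝ))).congr ?_
      filter_upwards [lt_mem_nhds hlt] with t ht
      simp [mem_Iic.2 ht.le]
    · refine (continuousAt_const (y := (0 : ℝ))).congr ?_
      filter_upwards [gt_mem_nhds hlt] with t ht
      simp [ht]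

/-- By continuity and monotonicity {F ≤ u} is an interval [0, s] with s its greatest element, and
the intermediate value theorem forces F(s) = u. So [0, u] has mass F(s) = u under the image law. -/
theorem map_condCDF (hz : ∀ t, κ z {t} = 0) :
    (κ z).map (fun t => condCDF κ t z) = volume := by
  have hc := continuous_condCDF hz
  have : IsProbabilityMeasure ((κ z).map (fun t => condCDF κ t z)) :=
    Measure.isProbabilityMeasure_map hc.measurable.aemeasurable
  refine Measure.ext_of_Iic _ _ fun u => ?_
  rw [Measure.map_apply hc.measurable measurableSet_Iic]
  let S : Set I := (fun t => condCDF κ t z) ⁻¹' Iic u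
  have hS : IsClosed S := isClosed_Iic.preimage hc
  have hne : S.Nonempty := ⟨0, by simp [S, condCDF_zero hz]⟩
  obtain ⟨s, hs⟩ := hS.isCompact.exists_isGreatest hne
  have hSe : S = Iic s := by
    ext t
    exact ⟨fun ht => hs.2 ht, fun ht => (condCDF_mono ht).trans hs.1⟩
  have hsu : condCDF κ s z = u := by
    obtain ⟨r, hr⟩ : u ∈ range fun t => condCDF κ t z := by
      refine mem_range_of_exists_le_of_exists_ge hc ⟨0, ?_⟩ ⟨1, ?_⟩
      · simp [condCDF_zero hz]
      · simpa [condCDF_one] using unitInterval.le_one'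
    refine le_antisymm hs.1 ?_
    rw [← hr]
    exact condCDF_mono (hs.2 (show condCDF κ r z ≤ u from hr.le))
  change κ z S = _
  have h1 : (κ z).real (Iic s) = u := congrArg Subtype.val hsu
  rw [hSe, ← ENNReal.ofReal_toReal (measure_ne_top (κ z) _), ← measureReal_def, h1]
  simp

end CondCDF

/-! ### Deterministic control of φ under a perturbed distribution function. -/

section FiniteSample

variable {d q : ℕ} {φ : Fin q → I → ℝ}

theorem Admissible.exists_bound (hφ : Admissible φ) : ∃ C : ℝ, 0 < C ∧ (∀ k u, |φ k u| ≤ C) ∧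
    ∀ k u v, |φ k u - φ k v| ≤ C * |(u : ℝ) - v| := by
  choose L hL using hφ.lipschitz
  have hLk : ∀ k u v, |φ k u - φ k v| ≤ L k * |(u : ℝ) - v| := fun k u v => by
    simpa [Real.dist_eq, Subtype.dist_eq] using (hL k).dist_le_mul u v
  have hb : ∀ k, ∃ C, ∀ u, |φ k u| ≤ C := fun k => by
    obtain ⟨C, hC⟩ := isCompact_univ.exists_bound_of_continuousOn (hL k).continuous.continuousOn
    exact ⟨C, fun u => hC u (mem_univ u)⟩
  choose B hB using hb
  refine ⟨1 + ∑ k, (|B k| + L k), by positivity, fun k u => ?_, fun k u v => ?_⟩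
  · have h := Finset.single_le_sum (f := fun k => |B k| + (L k : ℝ)) (fun k _ => by positivity)
      (Finset.mem_univ k)
    have := (L k).coe_nonneg
    linarith [hB k u, le_abs_self (B k)]
  · have h := Finset.single_le_sum (f := fun k => |B k| + (L k : ℝ)) (fun k _ => by positivity)
      (Finset.mem_univ k)
    refine (hLk k u v).trans (mul_le_mul_of_nonneg_right ?_ (abs_nonneg _))
    have := abs_nonneg (B k)
    linarith

theorem Admissible.continuous (hφ : Admissible φ) (k : Fin q) : Continuous (φ k) :=
  (hφ.lipschitz k).choose_spec.continuous

theorem Admissible.nonempty_tsupport (hφ : Admissible φ) (k : Fin q) : (tsupport (φ k)).Nonempty := by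
  by_contra h
  have h0 : φ k = 0 := tsupport_eq_empty_iff.1 (not_nonempty_iff_eq_empty.1 h)
  simpa [h0] using hφ.integral_sq_eq_one k

theorem isCompact_iUnion_tsupport (φ : Fin q → I → ℝ) :
    IsCompact ((fun u : I => (u : ℝ)) '' ⋃ k, tsupport (φ k)) :=
  (isCompact_iUnion fun k => (isClosed_tsupport (φ k)).isCompact).image continuous_subtype_val

theorem Admissible.tauMin_mem (hφ : Admissible φ) (k : Fin q) : tauMin φ ∈ Ioo (0 : ℝ) 1 := by
  obtain ⟨u, hu, hue⟩ := (isCompact_iUnion_tsupport φ).sInf_mem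
    (((hφ.nonempty_tsupport k).mono (subset_iUnion (fun k => tsupport (φ k)) k)).image _)
  obtain ⟨j, hj⟩ := mem_iUnion.1 hu
  rw [tauMin, ← hue]
  exact hφ.support_subset j hj

theorem Admissible.tauMax_mem (hφ : Admissible φ) (k : Fin q) : tauMax φ ∈ Ioo (0 : ℝ) 1 := by
  obtain ⟨u, hu, hue⟩ := (isCompact_iUnion_tsupport φ).sSup_mem
    (((hφ.nonempty_tsupport k).mono (subset_iUnion (fun k => tsupport (φ k)) k)).image _)
  obtain ⟨j, hj⟩ := mem_iUnion.1 hu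
  rw [tauMax, ← hue]
  exact hφ.support_subset j hj

theorem eq_zero_of_lt_tauMin {k : Fin q} {u : I} (hu : (u : ℝ) < tauMin φ) : φ k u = 0 := by
  by_contra h
  exact hu.not_ge (csInf_le (isCompact_iUnion_tsupport φ).bddBelow
    ⟨u, mem_iUnion.2 ⟨k, subset_tsupport _ h⟩, rfl⟩)

theorem eq_zero_of_tauMax_lt {k : Fin q} {u : I} (hu : tauMax φ < (u : ℝ)) : φ k u = 0 := by
  by_contra h
  exact hu.not_ge (le_csSup (isCompact_iUnion_tsupport φ).bddAbove
    ⟨u, mem_iUnion.2 ⟨k, subset_tsupport _ h⟩, rfl⟩)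

variable {κ : Kernel (Cube d) I} [IsMarkovKernel κ] {z : Cube d}

/-- For a continuous conditional distribution function the quantile is attained. -/
theorem exists_condQuantile (hz : ∀ t, κ z {t} = 0) {τ : ℝ} (hτ : τ ∈ Ioo (0 : ℝ) 1) :
    ∃ a : I, (a : ℝ) = condQuantile κ τ z ∧ (condCDF κ a z : ℝ) = τ ∧
      ∀ t : I, t < a → (condCDF κ t z : ℝ) < τ := by
  have hc := continuous_condCDF hz
  let S : Set I := {t : I | τ ≤ (condCDF κ t z : ℝ)}
  have hS : IsClosed S := isClosed_le continuous_const (continuous_subtype_val.comp hc)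
  have hne : S.Nonempty := ⟨1, by simp [S, condCDF_one, hτ.2.le]⟩
  obtain ⟨a, ha⟩ := hS.isCompact.exists_isLeast hne
  refine ⟨a, ?_, ?_, fun t ht => ?_⟩
  · have h : IsLeast ((fun t : I => (t : ℝ)) '' S) a :=
      ⟨mem_image_of_mem _ ha.1, by rintro _ ⟨t, ht, rfl⟩; exact ha.2 ht⟩
    exact h.csInf_eq.symm
  · refine le_antisymm ?_ ha.1
    obtain ⟨r, hr⟩ : (⟨τ, hτ.1.le, hτ.2.le⟩ : I) ∈ range fun t => condCDF κ t z := by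
      refine mem_range_of_exists_le_of_exists_ge hc ⟨0, ?_⟩ ⟨1, ?_⟩
      · simp [condCDF_zero hz]
      · simpa [condCDF_one] using unitInterval.le_one'
    have hr' : (condCDF κ r z : ℝ) = τ := congrArg Subtype.val hr
    rw [← hr']
    exact condCDF_mono (ha.2 hr'.ge)
  · by_contra! hcon
    exact ht.not_ge (ha.2 hcon)

/-- This bounds φ at an estimated rank that exceeds τ_min by at most δ: φ is 0 below τ_min and grows
at rate at most C. -/
theorem Admissible.abs_le_of_le_tauMin_add (hφ : Admissible φ) {C : ℝ} (hC0 : 0 < C)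
    (hC : ∀ k u v, |φ k u - φ k v| ≤ C * |(u : ℝ) - v|) {δ : ℝ} (hδ : 0 ≤ δ) (k : Fin q) {u : I}
    (hu : (u : ℝ) ≤ tauMin φ + δ) : |φ k u| ≤ C * δ := by
  obtain hlt | hle := lt_or_ge (u : ℝ) (tauMin φ)
  · rw [eq_zero_of_lt_tauMin hlt, abs_zero]
    positivity
  · have hτ := hφ.tauMin_mem k
    -- Vanishing is known strictly below τ_min, so `u` is compared with a point `v` slightly below
    -- it; the minimum with τ_min > 0 keeps `v` in [0, 1].
    refine le_of_forall_pos_le_add fun ε hε => ?_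
    have hη0 : 0 < min (ε / C) (tauMin φ) := lt_min (div_pos hε hC0) hτ.1
    have hη1 : min (ε / C) (tauMin φ) ≤ tauMin φ := min_le_right _ _
    have hη2 : C * min (ε / C) (tauMin φ) ≤ ε := by
      rw [mul_comm, ← le_div_iff₀ hC0]
      exact min_le_left _ _
    obtain ⟨v, hv⟩ : ∃ v : I, (v : ℝ) = tauMin φ - min (ε / C) (tauMin φ) :=
      ⟨⟨_, by linarith, by linarith [hτ.2]⟩, rfl⟩
    have h := hC k u v
    rw [eq_zero_of_lt_tauMin (show (v : ℝ) < tauMin φ by linarith), sub_zero] at h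
    have hle' : |(u : ℝ) - v| ≤ δ + min (ε / C) (tauMin φ) :=
      abs_le.2 ⟨by linarith, by linarith⟩
    linarith [mul_le_mul_of_nonneg_left hle' hC0.le]

theorem Admissible.abs_le_of_tauMax_sub_le (hφ : Admissible φ) {C : ℝ} (hC0 : 0 < C)
    (hC : ∀ k u v, |φ k u - φ k v| ≤ C * |(u : ℝ) - v|) {δ : ℝ} (hδ : 0 ≤ δ) (k : Fin q) {u : I}
    (hu : tauMax φ - δ ≤ u) : |φ k u| ≤ C * δ := by
  obtain hlt | hle := lt_or_ge (tauMax φ) (u : ℝ)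
  · rw [eq_zero_of_tauMax_lt hlt, abs_zero]
    positivity
  · have hτ := hφ.tauMax_mem k
    refine le_of_forall_pos_le_add fun ε hε => ?_
    have hη0 : 0 < min (ε / C) (1 - tauMax φ) := lt_min (div_pos hε hC0) (sub_pos.2 hτ.2)
    have hη1 : min (ε / C) (1 - tauMax φ) ≤ 1 - tauMax φ := min_le_right _ _
    have hη2 : C * min (ε / C) (1 - tauMax φ) ≤ ε := by
      rw [mul_comm, ← le_div_iff₀ hC0]
      exact min_le_left _ _
    obtain ⟨v, hv⟩ : ∃ v : I, (v : ℝ) = tauMax φ + min (ε / C) (1 - tauMax φ) :=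
      ⟨⟨_, by linarith [hτ.1], by linarith⟩, rfl⟩
    have h := hC k u v
    rw [eq_zero_of_tauMax_lt (show tauMax φ < (v : ℝ) by linarith), sub_zero] at h
    have hle' : |(u : ℝ) - v| ≤ δ + min (ε / C) (1 - tauMax φ) :=
      abs_le.2 ⟨by linarith, by linarith⟩
    linarith [mul_le_mul_of_nonneg_left hle' hC0.le]

/-- Transforming by a monotone estimate `e` of the conditional distribution function changes `φ` by
at most the error of `e` on the quantile range, even outside that range. -/
theorem Admissible.abs_sub_le (hφ : Admissible φ) {C : ℝ} (hC0 : 0 < C)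
    (hC : ∀ k u v, |φ k u - φ k v| ≤ C * |(u : ℝ) - v|) (hz : ∀ t, κ z {t} = 0) {e : I → I}
    (he : Monotone e) {δ : ℝ}
    (hδ : ∀ t ∈ quantileRange φ κ z, |(condCDF κ t z : ℝ) - e t| ≤ δ) (k : Fin q) (t : I) :
    |φ k (e t) - φ k (condCDF κ t z)| ≤ C * δ := by
  obtain ⟨a, haq, haF, hal⟩ := exists_condQuantile hz (hφ.tauMin_mem k)
  obtain ⟨b, hbq, hbF, hbl⟩ := exists_condQuantile hz (hφ.tauMax_mem k)
  have hτ : tauMin φ ≤ tauMax φ := by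
    have hne := ((hφ.nonempty_tsupport k).mono
      (subset_iUnion (fun k => tsupport (φ k)) k)).image (fun u : I => (u : ℝ))
    exact csInf_le_csSup hne (isCompact_iUnion_tsupport φ).bddBelow
      (isCompact_iUnion_tsupport φ).bddAbove
  have hab : a ≤ b := by
    by_contra! hcon
    exact absurd (hal b hcon) (by rw [hbF]; exact hτ.not_gt)
  have hrange : ∀ s, s ∈ quantileRange φ κ z ↔ a ≤ s ∧ s ≤ b := fun s => by
    rw [quantileRange, mem_ofPred_eq, ← haq, ← hbq]
    rfl
  have hδ0 : 0 ≤ δ := (abs_nonneg _).trans (hδ a ((hrange a).2 ⟨le_rfl, hab⟩))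
  by_cases ht : t ∈ quantileRange φ κ z
  · refine (hC k _ _).trans (mul_le_mul_of_nonneg_left ?_ hC0.le)
    rw [abs_sub_comm]
    exact hδ t ht
  · obtain hta | hbt : t < a ∨ b < t := by
      by_contra! hcon
      exact ht ((hrange t).2 hcon)
    -- Left of the range the true value is 0, and monotonicity gives e(t) ≤ e(a) ≤ F(a) + δ = τ_min
    -- + δ.
    · rw [eq_zero_of_lt_tauMin (hal t hta), sub_zero]
      refine hφ.abs_le_of_le_tauMin_add hC0 hC hδ0 k ?_
      have h1 := (abs_le.1 (hδ a ((hrange a).2 ⟨le_rfl, hab⟩))).1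
      have h2 : (e t : ℝ) ≤ e a := he hta.le
      linarith
    -- Right of the range F may be flat, so only F(t) ≥ τ_max holds; the case δ = 0 covers equality.
    · have h0 : |φ k (condCDF κ t z)| ≤ C * 0 := by
        refine hφ.abs_le_of_tauMax_sub_le hC0 hC le_rfl k ?_
        rw [sub_zero, ← hbF]
        exact condCDF_mono hbt.le
      rw [mul_zero, abs_nonpos_iff] at h0
      rw [h0, sub_zero]
      refine hφ.abs_le_of_tauMax_sub_le hC0 hC hδ0 k ?_
      have h1 := (abs_le.1 (hδ b ((hrange b).2 ⟨hab, le_rfl⟩))).2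
      have h2 : (e b : ℝ) ≤ e t := he hbt.le
      linarith

end FiniteSample

/-! ### Factorization under conditional independence and the law of the ranks. -/

section ConditionalIndependence

variable {d : ℕ} {P : ProbabilityMeasure (Obs d)} {κX κY : Kernel (Cube d) I}
  [IsMarkovKernel κX] [IsMarkovKernel κY]

theorem measurePreserving_obsZ_obsX {d : ℕ} :
    MeasurePreserving (fun w : Obs d => (obsZ w, obsX w)) volume volume :=
  Measure.measurePreserving_swap.comp
    ((MeasurePreserving.id (volume : Measure I)).prod
      (measurePreserving_snd (μ := (volume : Measure I)) (ν := (volume : Measure (Cube d)))))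

theorem measurePreserving_obsZ_obsY {d : ℕ} :
    MeasurePreserving (fun w : Obs d => (obsZ w, obsY w)) volume volume :=
  Measure.measurePreserving_swap.comp
    (measurePreserving_snd (μ := (volume : Measure I)) (ν := (volume : Measure (I × Cube d))))

theorem IsCondDistrib.condDistrib_ae_eq {V : Obs d → I} (hV : Measurable V)
    {κ : Kernel (Cube d) I} [IsMarkovKernel κ] (hκ : IsCondDistrib P V κ) :
    condDistrib V obsZ (P : Measure (Obs d)) =ᵐ[(P : Measure (Obs d)).map obsZ] κ := by
  refine condDistrib_ae_eq_of_measure_eq_compProd obsZ hV.aemeasurable ?_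
  have hdis := hκ.disintegrate
  rw [Measure.fst_map_prodMk hV] at hdis
  exact hdis.symm

/-- Conditional independence makes the conditional law of (X, Y) a product of the canonical
conditional laws, and these agree almost everywhere with the chosen versions. -/
theorem map_eq_compProd_prod (hP : P ∈ condIndepDistributions d)
    (hκX : IsCondDistrib P obsX κX) (hκY : IsCondDistrib P obsY κY) :
    (P : Measure (Obs d)).map (fun w => (obsZ w, obsX w, obsY w)) =
      (P : Measure (Obs d)).map obsZ ⊗ₘ (κX ×ₖ κY) := by
  rw [(condIndepFun_iff_map_prod_eq_prod_condDistrib_prod_condDistrib measurable_obsX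
    measurable_obsY measurable_obsZ).1 hP.2, ← Measure.compProd_eq_comp_prod]
  refine Measure.compProd_congr ?_
  filter_upwards [hκX.condDistrib_ae_eq measurable_obsX, hκY.condDistrib_ae_eq measurable_obsY]
    with z hX hY
  rw [Kernel.prod_apply, Kernel.prod_apply, hX, hY]

theorem integral_mul_eq_of_condIndep (hP : P ∈ condIndepDistributions d)
    (hκX : IsCondDistrib P obsX κX) (hκY : IsCondDistrib P obsY κY) {a b : I × Cube d → ℝ}
    (ha : Measurable a) (hb : Measurable b) {A B : ℝ} (hA : ∀ p, |a p| ≤ A) (hB : ∀ p, |b p| ≤ B) :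
    ∫ w, a (obsX w, obsZ w) * b (obsY w, obsZ w) ∂(P : Measure (Obs d)) =
      ∫ z, (∫ x, a (x, z) ∂(κX z)) * ∫ y, b (y, z) ∂(κY z) ∂((P : Measure (Obs d)).map obsZ) := by
  have hm : Measurable fun w : Obs d => (obsZ w, obsX w, obsY w) :=
    measurable_obsZ.prodMk (measurable_obsX.prodMk measurable_obsY)
  have hf : Measurable fun p : Cube d × I × I => a (p.2.1, p.1) * b (p.2.2, p.1) := by fun_prop
  have : IsProbabilityMeasure ((P : Measure (Obs d)).map obsZ) :=
    Measure.isProbabilityMeasure_map measurable_obsZ.aemeasurable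
  have h := integral_map (μ := (P : Measure (Obs d))) hm.aemeasurable hf.aestronglyMeasurable
  rw [← h, map_eq_compProd_prod hP hκX hκY, Measure.integral_compProd]
  · refine integral_congr_ae (ae_of_all _ fun z => ?_)
    simp only [Kernel.prod_apply]
    exact integral_prod_mul (fun x => a (x, z)) fun y => b (y, z)
  · refine .of_bound hf.aestronglyMeasurable (A * B) (ae_of_all _ fun p => ?_)
    rw [Real.norm_eq_abs, abs_mul]
    exact mul_le_mul (hA _) (hB _) (abs_nonneg _) ((abs_nonneg _).trans (hA (p.2.1, p.1)))

theorem measurable_ranks (κX κY : Kernel (Cube d) I) [IsMarkovKernel κX] [IsMarkovKernel κY] :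
    Measurable fun w : Obs d => (condCDF κX (obsX w) (obsZ w), condCDF κY (obsY w) (obsZ w)) :=
  ((measurable_condCDF κX).comp (measurable_obsX.prodMk measurable_obsZ)).prodMk
    ((measurable_condCDF κY).comp (measurable_obsY.prodMk measurable_obsZ))

/-- Under conditional independence the conditional ranks are independent and uniform. -/
theorem map_ranks_eq (hP : P ∈ condIndepDistributions d)
    (hκX : IsCondDistrib P obsX κX) (hκY : IsCondDistrib P obsY κY) :
    (P : Measure (Obs d)).map
      (fun w => (condCDF κX (obsX w) (obsZ w), condCDF κY (obsY w) (obsZ w))) =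
        (volume : Measure I).prod volume := by
  have hm : Measurable fun w : Obs d => (obsZ w, obsX w, obsY w) :=
    measurable_obsZ.prodMk (measurable_obsX.prodMk measurable_obsY)
  have hr : Measurable fun p : Cube d × I × I => (condCDF κX p.2.1 p.1, condCDF κY p.2.2 p.1) :=
    ((measurable_condCDF κX).comp (f := fun p : Cube d × I × I => (p.2.1, p.1))
      (by fun_prop)).prodMk
      ((measurable_condCDF κY).comp (f := fun p : Cube d × I × I => (p.2.2, p.1)) (by fun_prop))
  have : IsProbabilityMeasure ((P : Measure (Obs d)).map obsZ) :=
    Measure.isProbabilityMeasure_map measurable_obsZ.aemeasurable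
  have h := Measure.map_map (μ := (P : Measure (Obs d))) hr hm
  refine h.symm.trans ?_
  rw [map_eq_compProd_prod hP hκX hκY]
  ext s hs
  rw [Measure.map_apply hr hs, Measure.compProd_apply (hr hs)]
  calc ∫⁻ z, (κX ×ₖ κY) z (Prod.mk z ⁻¹' ((fun p : Cube d × I × I =>
        (condCDF κX p.2.1 p.1, condCDF κY p.2.2 p.1)) ⁻¹' s)) ∂((P : Measure (Obs d)).map obsZ)
      = ∫⁻ _, ((volume : Measure I).prod volume) s ∂((P : Measure (Obs d)).map obsZ) := by
        refine lintegral_congr_ae ?_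
        filter_upwards [ae_forall_measure_singleton_eq_zero hP.1 measurePreserving_obsZ_obsX hκX,
          ae_forall_measure_singleton_eq_zero hP.1 measurePreserving_obsZ_obsY hκY] with z hX hY
        have hcX := (continuous_condCDF hX).measurable
        have hcY := (continuous_condCDF hY).measurable
        have hvol : (volume : Measure I).prod (volume : Measure I) =
            ((κX z).map fun t => condCDF κX t z).prod ((κY z).map fun t => condCDF κY t z) := by
          rw [map_condCDF hX, map_condCDF hY]
        rw [Kernel.prod_apply, hvol, Measure.map_prod_map _ _ hcX hcY, Measure.map_apply (hcX.prodMap hcY) hs]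
        rfl
    _ = ((volume : Measure I).prod volume) s := by simp

end ConditionalIndependence

/-! ### Stochastic bounds for triangular arrays and the error terms they control. -/

section ArrayBigO

/-- The rows of the triangular array `A n w i`, `i < n`, are uniformly of order `a n` in
probability. -/
def ArrayBigO {Ω : ℕ → Type*} [∀ n, MeasurableSpace (Ω n)] (μ : ∀ n, Measure (Ω n))
    (A : ∀ n, Ω n → Fin n → ℝ) (a : ℕ → ℝ) : Prop :=
  ∀ ε : ℝ≥0∞, 0 < ε → ∃ M : ℝ, 0 < M ∧ ∀ n ≥ 1, μ n {w | ∃ i, M * |a n| < |A n w i|} ≤ ε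

variable {Ω : ℕ → Type*} [∀ n, MeasurableSpace (Ω n)] {μ : ∀ n, Measure (Ω n)}
  {A B : ∀ n, Ω n → Fin n → ℝ} {a b : ℕ → ℝ}

theorem ArrayBigO.tendsto_measure (hA : ArrayBigO μ A a) (ha : Tendsto a atTop (𝓝 0)) {η : ℝ}
    (hη : 0 < η) : Tendsto (fun n => μ n {w | ∃ i, η < |A n w i|}) atTop (𝓝 0) := by
  rw [ENNReal.tendsto_nhds_zero]
  intro ε hε
  obtain ⟨M, -, hM⟩ := hA ε hε
  have h1 : Tendsto (fun n => M * |a n|) atTop (𝓝 0) := by simpa using ha.abs.const_mul M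
  filter_upwards [h1.eventually_lt_const hη, eventually_ge_atTop 1] with n hn hn1
  refine (measure_mono ?_).trans (hM n hn1)
  rintro w ⟨i, hi⟩
  exact ⟨i, hn.trans hi⟩

theorem ArrayBigO.vanishesInProb_mean (hA : ArrayBigO μ A a) (ha : Tendsto a atTop (𝓝 0)) :
    VanishesInProb μ fun n w => (n : ℝ)⁻¹ * ∑ i, |A n w i| := by
  intro η hη
  refine tendsto_measure_zero_of_subset (hA.tendsto_measure ha hη) fun n w hw => ?_
  simp only [mem_ofPred_eq] at hw ⊢
  by_contra! hcon
  refine hw.not_ge ?_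
  have hs : ∑ i, |A n w i| ≤ n * η := by
    simpa using Finset.sum_le_card_nsmul Finset.univ _ η fun i _ => hcon i
  rw [abs_of_nonneg (mul_nonneg (by positivity) (Finset.sum_nonneg fun i _ => abs_nonneg _))]
  obtain rfl | hn := Nat.eq_zero_or_pos n
  · simpa using hη.le
  · rw [inv_mul_le_iff₀ (by exact_mod_cast hn)]
    exact hs

/-- Off an event of probability at most ε each of the n products is at most M N |a n b n|, and n /
√n = √n. This is where the product rate enters. -/
theorem ArrayBigO.vanishesInProb_sum_mul (hA : ArrayBigO μ A a) (hB : ArrayBigO μ B b)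
    (hab : Tendsto (fun n : ℕ => √(n : ℝ) * a n * b n) atTop (𝓝 0)) :
    VanishesInProb μ fun n w => (√(n : ℝ))⁻¹ * ∑ i, A n w i * B n w i := by
  intro η hη
  rw [ENNReal.tendsto_nhds_zero]
  intro ε hε
  obtain ⟨M, hM0, hM⟩ := hA (ε / 2) (ENNReal.half_pos hε.ne')
  obtain ⟨N, hN0, hN⟩ := hB (ε / 2) (ENNReal.half_pos hε.ne')
  have h1 : Tendsto (fun n : ℕ => M * N * |√(n : ℝ) * a n * b n|) atTop (𝓝 0) := by
    simpa using hab.abs.const_mul (M * N)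
  filter_upwards [h1.eventually_lt_const hη, eventually_ge_atTop 1] with n hn hn1
  have hsub : {w | η < |(√(n : ℝ))⁻¹ * ∑ i, A n w i * B n w i|} ⊆
      {w | ∃ i, M * |a n| < |A n w i|} ∪ {w | ∃ i, N * |b n| < |B n w i|} := by
    intro w hw
    by_contra hcon
    simp only [mem_union, mem_ofPred_eq, not_or, not_exists, not_lt] at hcon hw
    refine hw.not_ge (le_trans ?_ hn.le)
    have hs : |∑ i, A n w i * B n w i| ≤ n * ((M * |a n|) * (N * |b n|)) := by
      refine (Finset.abs_sum_le_sum_abs _ _).trans ?_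
      have := Finset.sum_le_card_nsmul Finset.univ (fun i => |A n w i * B n w i|)
        ((M * |a n|) * (N * |b n|)) fun i _ => by
          rw [abs_mul]
          exact mul_le_mul (hcon.1 i) (hcon.2 i) (abs_nonneg _) (by positivity)
      simpa using this
    have hsq : √(n : ℝ) * √(n : ℝ) = n := Real.mul_self_sqrt (by positivity)
    have hpos : 0 < √(n : ℝ) := Real.sqrt_pos.2 (by exact_mod_cast hn1)
    rw [abs_mul, abs_inv, abs_of_pos hpos, inv_mul_le_iff₀ hpos, abs_mul, abs_mul, abs_of_pos hpos]
    calc |∑ i, A n w i * B n w i| ≤ n * ((M * |a n|) * (N * |b n|)) := hs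
      _ = √(n : ℝ) * √(n : ℝ) * ((M * |a n|) * (N * |b n|)) := by rw [hsq]
      _ = √(n : ℝ) * (M * N * (√(n : ℝ) * |a n| * |b n|)) := by ring
  calc μ n {w | η < |(√(n : ℝ))⁻¹ * ∑ i, A n w i * B n w i|}
      ≤ ε / 2 + ε / 2 := (measure_mono hsub).trans ((measure_union_le _ _).trans
        (add_le_add (hM n hn1) (hN n hn1)))
    _ = ε := ENNReal.add_halves ε

variable {E α : Type*} [MeasurableSpace E] [MeasurableSpace α]

/-- The weights are functions of the `π`-data, to which the `ψ n` are orthogonal, so the normalized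
sum has second moment at most K² times the expected mean of D². Orthogonality absorbs the factor √n,
so `a → 0` at any speed suffices. -/
theorem ArrayBigO.vanishesInProb_cross {ν : ℕ → Measure E} [∀ n, IsProbabilityMeasure (ν n)]
    {π : E → α} (hπ : Measurable π) {ψ : ℕ → E → ℝ} (hψm : ∀ n, Measurable (ψ n)) {K : ℝ}
    (hK : ∀ n w, |ψ n w| ≤ K)
    (hψ : ∀ n, ∀ G : α → ℝ, Measurable G → (∃ c, ∀ a, |G a| ≤ c) →
      ∫ w, G (π w) * ψ n w ∂(ν n) = 0)
    {D : ∀ n, (Fin n → α) → Fin n → ℝ} (hDm : ∀ n i, Measurable fun v => D n v i) {c : ℝ}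
    (hD : ∀ n v i, |D n v i| ≤ c)
    (hA : ArrayBigO (fun n => Measure.pi fun _ : Fin n => ν n)
      (fun n w => D n fun m => π (w m)) a) (ha : Tendsto a atTop (𝓝 0)) :
    VanishesInProb (fun n => Measure.pi fun _ : Fin n => ν n)
      fun n w => (√(n : ℝ))⁻¹ * ∑ i, D n (fun m => π (w m)) i * ψ n (w i) := by
  have hDm' : ∀ n i, Measurable fun w : Fin n → E => D n (fun m => π (w m)) i := fun n i =>
    (hDm n i).comp (by fun_prop)
  -- From D² ≤ c |D|, the mean of squares vanishes with the mean of absolute values; being bounded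
  -- by c², it also vanishes in expectation.
  have hv : VanishesInProb (fun n => Measure.pi fun _ : Fin n => ν n)
      fun n w => (n : ℝ)⁻¹ * ∑ i, D n (fun m => π (w m)) i ^ 2 := by
    refine ((hA.vanishesInProb_mean ha).const_mul c).mono fun n w => ?_
    rw [abs_of_nonneg (by positivity)]
    refine le_trans ?_ (le_abs_self _)
    rw [mul_left_comm, Finset.mul_sum _ _ c]
    refine mul_le_mul_of_nonneg_left (Finset.sum_le_sum fun i _ => ?_) (by positivity)
    rw [← sq_abs, sq]
    exact mul_le_mul_of_nonneg_right (hD _ _ _) (abs_nonneg _)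
  have hb : ∀ n (w : Fin n → E), |(n : ℝ)⁻¹ * ∑ i, D n (fun m => π (w m)) i ^ 2| ≤ c ^ 2 := by
    intro n w
    have hs := Finset.sum_le_card_nsmul Finset.univ (fun i => D n (fun m => π (w m)) i ^ 2)
      (c ^ 2) fun i _ => by
        rw [← sq_abs]
        exact pow_le_pow_left₀ (abs_nonneg _) (hD _ _ _) 2
    rw [abs_of_nonneg (by positivity)]
    obtain rfl | hn := Nat.eq_zero_or_pos n
    · simpa using sq_nonneg c
    · rw [inv_mul_le_iff₀ (by exact_mod_cast hn)]
      simpa using hs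
  have ht := (hv.tendsto_integral
    (fun n => (Finset.measurable_sum _ fun i _ => (hDm' n i).pow_const 2).const_mul _) hb).const_mul
      (K ^ 2)
  rw [mul_zero] at ht
  have hm : ∀ n, Measurable fun w : Fin n → E =>
      (√(n : ℝ))⁻¹ * ∑ i, D n (fun m => π (w m)) i * ψ n (w i) := fun n =>
    (Finset.measurable_sum _ fun i _ => (hDm' n i).mul
      ((hψm n).comp (measurable_pi_apply i))).const_mul _
  refine vanishesInProb_of_tendsto_integral_sq (fun n => ?_)
    (squeeze_zero (fun n => integral_nonneg fun w => sq_nonneg _) (fun n => ?_) ht)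
  · refine .of_bound ((hm n).pow_const 2).aestronglyMeasurable
      (((√(n : ℝ))⁻¹ * (n * (c * K))) ^ 2) (ae_of_all _ fun w => ?_)
    rw [Real.norm_eq_abs, abs_pow]
    refine pow_le_pow_left₀ (abs_nonneg _) ?_ 2
    rw [abs_mul, abs_of_nonneg (a := (√(n : ℝ))⁻¹) (by positivity)]
    refine mul_le_mul_of_nonneg_left ((Finset.abs_sum_le_sum_abs _ _).trans ?_) (by positivity)
    have hs := Finset.sum_le_card_nsmul Finset.univ
      (fun i => |D n (fun m => π (w m)) i * ψ n (w i)|) (c * K) fun i _ => by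
        rw [abs_mul]
        exact mul_le_mul (hD _ _ _) (hK _ _) (abs_nonneg _) ((abs_nonneg _).trans (hD n (fun m => π (w m)) i))
    simpa using hs
  · simp only [mul_pow]
    rw [integral_const_mul, inv_pow, Real.sq_sqrt (by positivity)]
    have h := integral_sq_sum_mul_le (ν n) hπ (hψm n) (hK n) (hψ n) (hDm n) (hD n)
    refine (mul_le_mul_of_nonneg_left h (by positivity)).trans (le_of_eq ?_)
    rw [mul_left_comm, ← integral_const_mul]
    refine congrArg _ (integral_congr_ae (ae_of_all _ fun w => ?_))
    exact (abs_of_nonneg (by positivity)).symm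

/-- The weak law of large numbers for bounded centered variables whose law may change with the
sample size. -/
theorem vanishesInProb_mean_of_integral_eq_zero {ν : ℕ → Measure E}
    [∀ n, IsProbabilityMeasure (ν n)] {ψ : ℕ → E → ℝ} (hψm : ∀ n, Measurable (ψ n)) {K : ℝ}
    (hK : ∀ n w, |ψ n w| ≤ K) (hψ : ∀ n, ∫ w, ψ n w ∂(ν n) = 0) :
    VanishesInProb (fun n => Measure.pi fun _ : Fin n => ν n)
      fun n w => (n : ℝ)⁻¹ * ∑ i, ψ n (w i) := by
  have hm : ∀ n, Measurable fun w : Fin n → E => (n : ℝ)⁻¹ * ∑ i, ψ n (w i) := fun n =>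
    (Finset.measurable_sum _ fun i _ => (hψm n).comp (measurable_pi_apply i)).const_mul _
  have ht : Tendsto (fun n : ℕ => K ^ 2 * (n : ℝ)⁻¹) atTop (𝓝 0) := by
    simpa using (tendsto_inv_atTop_zero.comp tendsto_natCast_atTop_atTop).const_mul (K ^ 2)
  refine vanishesInProb_of_tendsto_integral_sq (fun n => ?_)
    (squeeze_zero (fun n => integral_nonneg fun w => sq_nonneg _) (fun n => ?_) ht)
  · refine .of_bound ((hm n).pow_const 2).aestronglyMeasurable
      (((n : ℝ)⁻¹ * (n * K)) ^ 2) (ae_of_all _ fun w => ?_)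
    rw [Real.norm_eq_abs, abs_pow]
    refine pow_le_pow_left₀ (abs_nonneg _) ?_ 2
    rw [abs_mul, abs_of_nonneg (a := (n : ℝ)⁻¹) (by positivity)]
    refine mul_le_mul_of_nonneg_left ((Finset.abs_sum_le_sum_abs _ _).trans ?_) (by positivity)
    simpa using Finset.sum_le_card_nsmul Finset.univ (fun i => |ψ n (w i)|) K fun i _ => hK _ _
  · simp only [mul_pow]
    rw [integral_const_mul]
    -- With trivial `π` and unit weights the orthogonality condition is just centering, and the
    -- second moment of the sum is at most K² n.
    have h := integral_sq_sum_mul_le (ν n) (π := fun _ => ()) measurable_const (hψm n) (hK n)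
      (fun G _ _ => by rw [integral_const_mul, hψ, mul_zero]) (n := n) (D := fun _ _ => 1)
      (fun _ => measurable_const) (c := 1) (fun _ _ => by simp)
    simp only [one_mul, one_pow, Finset.sum_const, Finset.card_univ, Fintype.card_fin,
      nsmul_eq_mul, mul_one, integral_const, probReal_univ, smul_eq_mul] at h
    refine (mul_le_mul_of_nonneg_left h (by positivity)).trans (le_of_eq ?_)
    obtain rfl | hn := Nat.eq_zero_or_pos n
    · simp
    · have : (n : ℝ) ≠ 0 := by exact_mod_cast hn.ne'
      field_simp

end ArrayBigO

/-! ### Errors of the estimated ranks. -/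

section RankError

variable {d q : ℕ} {φ : Fin q → I → ℝ}

/-- The error in `ψ(F(V_i | Z_i))` made by estimating the conditional distribution function. -/
def rankError {d : ℕ} (ψ : I → ℝ) (F : CDFEstimator d) (κ : Kernel (Cube d) I) [IsMarkovKernel κ]
    (n : ℕ) (s : Fin n → I × Cube d) (i : Fin n) : ℝ :=
  ψ (F.est n s (s i).1 (s i).2) - ψ (condCDF κ (s i).1 (s i).2)

theorem measurable_est_apply (F : CDFEstimator d) {n : ℕ} (i : Fin n) :
    Measurable fun s : Fin n → I × Cube d => F.est n s (s i).1 (s i).2 :=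
  (F.measurable_est n).comp
    (f := fun s : Fin n → I × Cube d => (s, (s i).1, (s i).2)) (by fun_prop)

theorem measurable_rankError {ψ : I → ℝ} (hψ : Continuous ψ) (F : CDFEstimator d)
    (κ : Kernel (Cube d) I) [IsMarkovKernel κ] {n : ℕ} (i : Fin n) :
    Measurable fun s => rankError ψ F κ n s i :=
  (hψ.measurable.comp (measurable_est_apply F i)).sub
    (hψ.measurable.comp ((measurable_condCDF κ).comp (measurable_pi_apply i)))

theorem abs_rankError_le {ψ : I → ℝ} {C : ℝ} (hC : ∀ u, |ψ u| ≤ C) (F : CDFEstimator d)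
    (κ : Kernel (Cube d) I) [IsMarkovKernel κ] {n : ℕ} (s : Fin n → I × Cube d) (i : Fin n) :
    |rankError ψ F κ n s i| ≤ C + C :=
  (abs_sub _ _).trans (add_le_add (hC _) (hC _))

/-- The deterministic bound `Admissible.abs_sub_le` applies at each Z_i whose conditional law is
atomless, which almost surely holds for all finitely many i at once. -/
theorem Admissible.arrayBigO_rankError (hφ : Admissible φ)
    {P₀ : Set (ProbabilityMeasure (Obs d))} {κ : ProbabilityMeasure (Obs d) → Kernel (Cube d) I}
    [∀ P, IsMarkovKernel (κ P)]
    (hκ : ∀ P ∈ P₀, ∀ᵐ z ∂((P : Measure (Obs d)).map obsZ), ∀ t, κ P z {t} = 0)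
    {V : Obs d → I} {F : CDFEstimator d} {a : ℕ → ℝ}
    (hF : UniformBigO P₀ (fun P n w => innerNorm φ (κ P) fun t z =>
      (condCDF (κ P) t z : ℝ) - (F.est n (fun i => (V (w i), obsZ (w i))) t z : ℝ)) a)
    {P : ℕ → ProbabilityMeasure (Obs d)} (hP : ∀ n, P n ∈ P₀) (k : Fin q) :
    ArrayBigO (fun n => sampleLaw (P n) n)
      (fun n w => rankError (φ k) F (κ (P n)) n fun i => (V (w i), obsZ (w i))) a := by
  obtain ⟨C, hC0, -, hC⟩ := hφ.exists_bound
  intro ε hε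
  -- Here ε may be infinite while `UniformBigO` takes a real tolerance, hence the truncation at 1.
  have hε1 : min ε 1 ≠ ⊤ := ((min_le_right _ _).trans_lt ENNReal.one_lt_top).ne
  obtain ⟨M, hM0, hM⟩ := hF (min ε 1).toReal
    (ENNReal.toReal_pos (lt_min hε one_pos).ne' hε1)
  refine ⟨C * M, by positivity, fun n hn => ?_⟩
  have hle : sampleLaw (P n) n {w | ENNReal.ofReal (M * |a n|) < innerNorm φ (κ (P n)) fun t z =>
      (condCDF (κ (P n)) t z : ℝ) - (F.est n (fun i => (V (w i), obsZ (w i))) t z : ℝ)} ≤ ε := by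
    refine le_trans ?_ (hM.le.trans ((ENNReal.ofReal_toReal hε1).le.trans (min_le_left _ _)))
    exact le_iSup₂_of_le n hn (le_iSup₂_of_le (P n) (hP n) le_rfl)
  refine le_trans (measure_mono_ae ?_) hle
  have hae : ∀ᵐ w ∂(sampleLaw (P n) n), ∀ i, ∀ t, κ (P n) (obsZ (w i)) {t} = 0 := by
    refine ae_all_iff.2 fun i => ?_
    exact (measurePreserving_eval (fun _ : Fin n => (P n : Measure (Obs d))) i).quasiMeasurePreserving.ae
      (ae_of_ae_map measurable_obsZ.aemeasurable (hκ (P n) (hP n)))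
  filter_upwards [hae] with w hw
  rintro ⟨i, hi⟩
  by_contra hcon
  have hcon' : innerNorm φ (κ (P n)) (fun t z =>
      (condCDF (κ (P n)) t z : ℝ) - (F.est n (fun i => (V (w i), obsZ (w i))) t z : ℝ)) ≤
        ENNReal.ofReal (M * |a n|) := not_lt.1 hcon
  refine hi.not_ge ?_
  rw [mul_assoc]
  refine hφ.abs_sub_le hC0 hC (hw i) (F.monotone_est n _ _) (fun t ht => ?_) k _
  rw [← ENNReal.ofReal_le_ofReal_iff (by positivity)]
  refine le_trans ?_ hcon'
  exact le_iSup_of_le (obsZ (w i)) (le_iSup₂_of_le t ht le_rfl)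

end RankError

/-! ### Mean and covariance of the limit law. -/

section Limit

variable {q : ℕ} {φ : Fin q → I → ℝ}

theorem integrable_of_continuous_of_compactSpace {α : Type*} [TopologicalSpace α] [CompactSpace α]
    [MeasurableSpace α] [OpensMeasurableSpace α] {μ : Measure α}
    [IsFiniteMeasure μ] {f : α → ℝ} (hf : Continuous f) : Integrable f μ := by
  obtain ⟨C, hC⟩ := isCompact_univ.exists_bound_of_continuousOn hf.continuousOn
  exact .of_bound hf.measurable.aestronglyMeasurable C (ae_of_all _ fun u => hC u (mem_univ u))

/-- The linear form `t` evaluated at the matrix `φ(u₁) φ(u₂)ᵀ`. -/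
def bilinearScore (φ : Fin q → I → ℝ) (t : EuclideanSpace ℝ (Fin q × Fin q)) (u : I × I) : ℝ :=
  ∑ kl, t kl * (φ kl.1 u.1 * φ kl.2 u.2)

theorem Admissible.continuous_bilinearScore (hφ : Admissible φ)
    (t : EuclideanSpace ℝ (Fin q × Fin q)) : Continuous (bilinearScore φ t) :=
  continuous_finsetSum _ fun kl _ => continuous_const.mul
    (((hφ.continuous kl.1).comp continuous_fst).mul ((hφ.continuous kl.2).comp continuous_snd))

theorem Admissible.integral_bilinearScore (hφ : Admissible φ)
    (t : EuclideanSpace ℝ (Fin q × Fin q)) :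
    ∫ u, bilinearScore φ t u ∂((volume : Measure I).prod volume) = 0 := by
  have hc : ∀ kl : Fin q × Fin q, Continuous fun u : I × I => t kl * (φ kl.1 u.1 * φ kl.2 u.2) :=
    fun kl => continuous_const.mul
      (((hφ.continuous kl.1).comp continuous_fst).mul ((hφ.continuous kl.2).comp continuous_snd))
  simp only [bilinearScore]
  rw [integral_finsetSum _ fun kl _ => integrable_of_continuous_of_compactSpace (hc kl)]
  refine Finset.sum_eq_zero fun kl _ => ?_
  rw [integral_const_mul, integral_prod_mul, hφ.integral_eq_zero, zero_mul, mul_zero]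

theorem Admissible.integral_bilinearScore_sq (hφ : Admissible φ)
    (t : EuclideanSpace ℝ (Fin q × Fin q)) :
    ∫ u, bilinearScore φ t u ^ 2 ∂((volume : Measure I).prod volume) =
      t ⬝ᵥ (gram φ ⊗ₖ gram φ).mulVec t := by
  have hexp : ∀ u : I × I, bilinearScore φ t u ^ 2 = ∑ kl, ∑ st, t kl * t st *
      ((φ kl.1 u.1 * φ st.1 u.1) * (φ kl.2 u.2 * φ st.2 u.2)) := fun u => by
    rw [sq, bilinearScore, Finset.sum_mul_sum]
    exact Finset.sum_congr rfl fun _ _ => Finset.sum_congr rfl fun _ _ => by ring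
  have hi : ∀ kl st : Fin q × Fin q, Integrable (fun u : I × I => t kl * t st *
      ((φ kl.1 u.1 * φ st.1 u.1) * (φ kl.2 u.2 * φ st.2 u.2)))
      ((volume : Measure I).prod volume) := fun kl st => by
    have h1 := hφ.continuous kl.1
    have h2 := hφ.continuous kl.2
    have h3 := hφ.continuous st.1
    have h4 := hφ.continuous st.2
    exact integrable_of_continuous_of_compactSpace (by fun_prop)
  simp only [hexp]
  rw [integral_finsetSum _ fun kl _ => integrable_finsetSum _ fun st _ => hi kl st]
  simp only [dotProduct, Matrix.mulVec, Finset.mul_sum]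
  refine Finset.sum_congr rfl fun kl _ => ?_
  rw [integral_finsetSum _ fun st _ => hi kl st]
  refine Finset.sum_congr rfl fun st _ => ?_
  rw [integral_const_mul, integral_prod_mul (fun u => φ kl.1 u * φ st.1 u)
    (fun u => φ kl.2 u * φ st.2 u), Matrix.kroneckerMap_apply]
  simp only [gram, Matrix.of_apply]
  ring

/-- The quadratic form is ∫ (∑ x_k φ_k)². Positivity passes to the Kronecker square and makes the
characteristic function formula of the Gaussian limit available. -/
theorem Admissible.posSemidef_gram (hφ : Admissible φ) : (gram φ).PosSemidef := by
  refine Matrix.PosSemidef.of_dotProduct_mulVec_nonneg ?_ fun x => ?_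
  · ext k s
    simp [gram, mul_comm]
  · have hi : ∀ k s, Integrable (fun u => x k * x s * (φ k u * φ s u)) volume := fun k s =>
      integrable_of_continuous_of_compactSpace
        (continuous_const.mul ((hφ.continuous k).mul (hφ.continuous s)))
    have h : star x ⬝ᵥ (gram φ).mulVec x = ∫ u, (∑ k, x k * φ k u) ^ 2 := by
      have hexp : ∀ u, (∑ k, x k * φ k u) ^ 2 = ∑ k, ∑ s, x k * x s * (φ k u * φ s u) := fun u => by
        rw [sq, Finset.sum_mul_sum]
        exact Finset.sum_congr rfl fun _ _ => Finset.sum_congr rfl fun _ _ => by ring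
      simp only [hexp]
      rw [integral_finsetSum _ fun k _ => integrable_finsetSum _ fun s _ => hi k s]
      simp only [dotProduct, Matrix.mulVec, Finset.mul_sum]
      refine Finset.sum_congr rfl fun k _ => ?_
      rw [integral_finsetSum _ fun s _ => hi k s]
      refine Finset.sum_congr rfl fun s _ => ?_
      rw [integral_const_mul]
      simp only [gram, Matrix.of_apply, Pi.star_apply, star_trivial]
      ring
    rw [h]
    exact integral_nonneg fun u => sq_nonneg _

end Limit

/-! ### Orthogonality of the ranks and the oracle statistic. -/

section Statistic

variable {d q : ℕ} {φ : Fin q → I → ℝ}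

instance isProbabilityMeasure_sampleLaw (P : ProbabilityMeasure (Obs d)) (n : ℕ) :
    IsProbabilityMeasure (sampleLaw P n) :=
  inferInstanceAs (IsProbabilityMeasure (Measure.pi fun _ : Fin n => (P : Measure (Obs d))))

theorem measurable_obsX_obsZ : Measurable fun w : Obs d => (obsX w, obsZ w) :=
  measurable_obsX.prodMk measurable_obsZ

theorem measurable_obsY_obsZ : Measurable fun w : Obs d => (obsY w, obsZ w) :=
  measurable_obsY.prodMk measurable_obsZ

theorem Admissible.measurable_rhoHat (hφ : Admissible φ) (FX FY : CDFEstimator d) (n : ℕ) :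
    Measurable (rhoHat φ FX FY n) := by
  refine (WithLp.measurable_toLp 2 _).comp (measurable_pi_lambda _ fun kl => ?_)
  refine (Finset.measurable_sum _ fun i _ => ?_).const_mul _
  refine ((hφ.continuous kl.1).measurable.comp ?_).mul ((hφ.continuous kl.2).measurable.comp ?_)
  · exact (measurable_est_apply FX i).comp
      (measurable_pi_lambda _ fun j => measurable_obsX_obsZ.comp (measurable_pi_apply j))
  · exact (measurable_est_apply FY i).comp
      (measurable_pi_lambda _ fun j => measurable_obsY_obsZ.comp (measurable_pi_apply j))

variable {κX κY : Kernel (Cube d) I} [IsMarkovKernel κX] [IsMarkovKernel κY]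
  {P : ProbabilityMeasure (Obs d)}

theorem Admissible.integral_comp_condCDF (hφ : Admissible φ) {κ : Kernel (Cube d) I}
    [IsMarkovKernel κ] {z : Cube d} (hz : ∀ t, κ z {t} = 0) (k : Fin q) :
    ∫ x, φ k (condCDF κ x z) ∂(κ z) = 0 := by
  have h := integral_map (μ := κ z) (continuous_condCDF hz).measurable.aemeasurable
    (hφ.continuous k).measurable.aestronglyMeasurable
  rw [← h, map_condCDF hz, hφ.integral_eq_zero]

/-- Given Z the integral factors, and the factor of φ_l(U₂) is ∫ φ_l = 0 since U₂ is conditionally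
uniform. This is the orthogonality needed for the cross terms. -/
theorem Admissible.integral_mul_rankY_eq_zero (hφ : Admissible φ)
    (hP : P ∈ condIndepDistributions d) (hκX : IsCondDistrib P obsX κX)
    (hκY : IsCondDistrib P obsY κY) (l : Fin q) (G : I × Cube d → ℝ) (hG : Measurable G)
    (hGb : ∃ c, ∀ a, |G a| ≤ c) :
    ∫ w, G (obsX w, obsZ w) * φ l (condCDF κY (obsY w) (obsZ w)) ∂(P : Measure (Obs d)) = 0 := by
  obtain ⟨C, -, hC, -⟩ := hφ.exists_bound
  obtain ⟨c, hc⟩ := hGb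
  have h := integral_mul_eq_of_condIndep hP hκX hκY hG
    (b := fun p => φ l (condCDF κY p.1 p.2))
    ((hφ.continuous l).measurable.comp (measurable_condCDF κY)) hc fun p => hC l _
  refine h.trans (integral_eq_zero_of_ae ?_)
  filter_upwards [ae_forall_measure_singleton_eq_zero hP.1 measurePreserving_obsZ_obsY hκY]
    with z hz
  simp [hφ.integral_comp_condCDF hz]

theorem Admissible.integral_mul_rankX_eq_zero (hφ : Admissible φ)
    (hP : P ∈ condIndepDistributions d) (hκX : IsCondDistrib P obsX κX)
    (hκY : IsCondDistrib P obsY κY) (k : Fin q) (G : I × Cube d → ℝ) (hG : Measurable G)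
    (hGb : ∃ c, ∀ a, |G a| ≤ c) :
    ∫ w, G (obsY w, obsZ w) * φ k (condCDF κX (obsX w) (obsZ w)) ∂(P : Measure (Obs d)) = 0 := by
  obtain ⟨C, -, hC, -⟩ := hφ.exists_bound
  obtain ⟨c, hc⟩ := hGb
  have h := integral_mul_eq_of_condIndep hP hκX hκY (a := fun p => φ k (condCDF κX p.1 p.2))
    ((hφ.continuous k).measurable.comp (measurable_condCDF κX)) hG (fun p => hC k _) hc
  simp only [mul_comm (G _)]
  refine h.trans (integral_eq_zero_of_ae ?_)
  filter_upwards [ae_forall_measure_singleton_eq_zero hP.1 measurePreserving_obsZ_obsX hκX]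
    with z hz
  simp [hφ.integral_comp_condCDF hz]

/-- Under conditional independence the characteristic function of the oracle statistic is a power
that does not depend on the distribution. -/
theorem Admissible.integral_cexp_bilinearScore (hφ : Admissible φ)
    (hP : P ∈ condIndepDistributions d) (hκX : IsCondDistrib P obsX κX)
    (hκY : IsCondDistrib P obsY κY) (t : EuclideanSpace ℝ (Fin q × Fin q)) (n : ℕ) :
    ∫ w, Complex.exp (((√(n : ℝ))⁻¹ * ∑ i, bilinearScore φ t
        (condCDF κX (obsX (w i)) (obsZ (w i)), condCDF κY (obsY (w i)) (obsZ (w i))) : ℝ) *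
          Complex.I) ∂(sampleLaw P n) =
      (∫ u, Complex.exp (((√(n : ℝ))⁻¹ * bilinearScore φ t u : ℝ) * Complex.I)
        ∂((volume : Measure I).prod volume)) ^ n := by
  have hb := (hφ.continuous_bilinearScore t).measurable
  have hprod := integral_fintype_prod_eq_prod (𝕜 := ℂ)
    (μ := fun _ : Fin n => (P : Measure (Obs d)))
    (f := fun _ w => Complex.exp (((√(n : ℝ))⁻¹ * bilinearScore φ t
        (condCDF κX (obsX w) (obsZ w), condCDF κY (obsY w) (obsZ w)) : ℝ) * Complex.I))
  have hlaw := integral_map (μ := (P : Measure (Obs d))) (measurable_ranks κX κY).aemeasurable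
    (f := fun u => Complex.exp (((√(n : ℝ))⁻¹ * bilinearScore φ t u : ℝ) * Complex.I))
    (by fun_prop)
  rw [map_ranks_eq hP hκX hκY] at hlaw
  rw [hlaw]
  simp only [Finset.prod_const, Finset.card_univ, Fintype.card_fin] at hprod
  rw [← hprod, sampleLaw]
  refine integral_congr_ae (ae_of_all _ fun w => ?_)
  simp only
  rw [← Complex.exp_sum, Finset.mul_sum, ← Finset.sum_mul]
  push_cast
  rfl

end Statistic

/-! ### Assembly of consistency and asymptotic normality. -/

section Main

variable {d q : ℕ} {φ : Fin q → I → ℝ} {P₀ : Set (ProbabilityMeasure (Obs d))}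
  {κX κY : ProbabilityMeasure (Obs d) → Kernel (Cube d) I}
  [∀ P, IsMarkovKernel (κX P)] [∀ P, IsMarkovKernel (κY P)]
  {FX FY : CDFEstimator d} {g h : ℕ → ℝ}

theorem norm_le_sum_abs {ι : Type*} [Fintype ι] (x : EuclideanSpace ℝ ι) : ‖x‖ ≤ ∑ i, |x i| := by
  rw [EuclideanSpace.norm_eq]
  refine Real.sqrt_le_iff.2 ⟨Finset.sum_nonneg fun i _ => abs_nonneg _, ?_⟩
  simpa using Finset.sum_sq_le_sq_sum_of_nonneg (s := Finset.univ) (f := fun i => |x i|)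
    fun i _ => abs_nonneg _

theorem vanishesInProb_rhoHat_sub_rho (hφ : Admissible φ) (hP₀ : P₀ ⊆ acDistributions d)
    (hκX : ∀ P ∈ P₀, IsCondDistrib P obsX (κX P)) (hκY : ∀ P ∈ P₀, IsCondDistrib P obsY (κY P))
    (hcons : UniformlyConsistent φ P₀ κX κY FX FY g h) {P : ℕ → ProbabilityMeasure (Obs d)}
    (hP : ∀ n, P n ∈ P₀) (kl : Fin q × Fin q) :
    VanishesInProb (fun n => sampleLaw (P n) n) fun n w =>
      rhoHat φ FX FY n w kl - rho φ (P n) (κX (P n)) (κY (P n)) kl := by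
  obtain ⟨C, hC0, hC, -⟩ := hφ.exists_bound
  have hA := hφ.arrayBigO_rankError (V := obsX) (fun P hP => ae_forall_measure_singleton_eq_zero
    (hP₀ hP) measurePreserving_obsZ_obsX (hκX P hP)) hcons.inner_X hP kl.1
  have hB := hφ.arrayBigO_rankError (V := obsY) (fun P hP => ae_forall_measure_singleton_eq_zero
    (hP₀ hP) measurePreserving_obsZ_obsY (hκY P hP)) hcons.inner_Y hP kl.2
  let ψ : ℕ → Obs d → ℝ := fun n w => φ kl.1 (condCDF (κX (P n)) (obsX w) (obsZ w)) *
    φ kl.2 (condCDF (κY (P n)) (obsY w) (obsZ w))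
  have hψm : ∀ n, Measurable (ψ n) := fun n =>
    ((hφ.continuous kl.1).measurable.comp (measurable_ranks (κX (P n)) (κY (P n))).fst).mul
      ((hφ.continuous kl.2).measurable.comp (measurable_ranks (κX (P n)) (κY (P n))).snd)
  have hψb : ∀ n w, |ψ n w| ≤ C * C := fun n w => by
    rw [abs_mul]
    exact mul_le_mul (hC _ _) (hC _ _) (abs_nonneg _) hC0.le
  have hψi : ∀ n, Integrable (ψ n) (P n : Measure (Obs d)) := fun n =>
    .of_bound (hψm n).aestronglyMeasurable (C * C) (ae_of_all _ fun w => hψb n w)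
  have hrho : ∀ n, |∫ w, ψ n w ∂(P n : Measure (Obs d))| ≤ C * C := fun n => by
    have := norm_integral_le_of_norm_le_const (μ := (P n : Measure (Obs d)))
      (f := ψ n) (C := C * C) (ae_of_all _ fun w => hψb n w)
    simpa using this
  have hlln := vanishesInProb_mean_of_integral_eq_zero (ν := fun n => (P n : Measure (Obs d)))
    (ψ := fun n w => ψ n w - ∫ w, ψ n w ∂(P n : Measure (Obs d)))
    (fun n => (hψm n).sub_const _) (K := C * C + C * C)
    (fun n w => (abs_sub _ _).trans (add_le_add (hψb n w) (hrho n)))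
    (fun n => by rw [integral_sub (hψi n) (integrable_const _)]; simp)
  have hsum := (hlln.abs.add ((hA.vanishesInProb_mean hcons.g_tendsto).const_mul C)).add
    ((hB.vanishesInProb_mean hcons.h_tendsto).const_mul C)
  refine hsum.mono_of_eventually ?_
  -- For n = 0 the statistic is 0 while ρ need not be, so the decomposition requires n ≥ 1.
  filter_upwards [eventually_ge_atTop 1] with n hn w
  have hn0 : (n : ℝ) ≠ 0 := by positivity
  refine le_trans ?_ (le_abs_self _)
  set A := fun i => rankError (φ kl.1) FX (κX (P n)) n (fun i => (obsX (w i), obsZ (w i))) i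
  set B := fun i => rankError (φ kl.2) FY (κY (P n)) n (fun i => (obsY (w i), obsZ (w i))) i
  -- No product of errors appears here: âb̂ - ab = (â - a) b̂ + (b̂ - b) a, and the remaining
  -- factors are bounded by C.
  have hdec : rhoHat φ FX FY n w kl - rho φ (P n) (κX (P n)) (κY (P n)) kl =
      (n : ℝ)⁻¹ * ∑ i, (ψ n (w i) - ∫ w, ψ n w ∂(P n : Measure (Obs d))) +
      (n : ℝ)⁻¹ * ∑ i, A i * φ kl.2 (estY FY n w (obsY (w i)) (obsZ (w i))) +
      (n : ℝ)⁻¹ * ∑ i, B i * φ kl.1 (condCDF (κX (P n)) (obsX (w i)) (obsZ (w i))) := by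
    have hc : (n : ℝ)⁻¹ * ∑ _i : Fin n, ∫ w, ψ n w ∂(P n : Measure (Obs d)) =
        ∫ w, ψ n w ∂(P n : Measure (Obs d)) := by
      simp [hn0]
    have h1 : rhoHat φ FX FY n w kl = (n : ℝ)⁻¹ * ∑ i, (ψ n (w i) +
        A i * φ kl.2 (estY FY n w (obsY (w i)) (obsZ (w i))) +
        B i * φ kl.1 (condCDF (κX (P n)) (obsX (w i)) (obsZ (w i)))) := by
      simp only [rhoHat, one_div]
      refine congrArg _ (Finset.sum_congr rfl fun i _ => ?_)
      simp only [A, B, ψ, rankError, estX, estY]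
      ring
    have h2 : rho φ (P n) (κX (P n)) (κY (P n)) kl = ∫ w, ψ n w ∂(P n : Measure (Obs d)) := rfl
    rw [h1, h2, Finset.sum_sub_distrib, mul_sub, hc, Finset.sum_add_distrib,
      Finset.sum_add_distrib]
    ring
  have hbd : ∀ (D b : Fin n → ℝ), (∀ i, |b i| ≤ C) →
      |(n : ℝ)⁻¹ * ∑ i, D i * b i| ≤ C * ((n : ℝ)⁻¹ * ∑ i, |D i|) := fun D b hb => by
    rw [abs_mul, abs_of_nonneg (a := (n : ℝ)⁻¹) (by positivity), mul_left_comm, Finset.mul_sum _ _ C]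
    refine mul_le_mul_of_nonneg_left ((Finset.abs_sum_le_sum_abs _ _).trans
      (Finset.sum_le_sum fun i _ => ?_)) (by positivity)
    rw [abs_mul, mul_comm]
    exact mul_le_mul_of_nonneg_right (hb i) (abs_nonneg _)
  rw [hdec]
  exact (abs_add_le _ _).trans (add_le_add ((abs_add_le _ _).trans (add_le_add le_rfl
    (hbd _ _ fun i => hC _ _))) (hbd _ _ fun i => hC _ _))

theorem vanishesInProb_inner_rhoHat_sub (hφ : Admissible φ)
    (hκX : ∀ P ∈ P₀, IsCondDistrib P obsX (κX P)) (hκY : ∀ P ∈ P₀, IsCondDistrib P obsY (κY P))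
    (hP₀ : P₀ ⊆ acDistributions d)
    (hcons : UniformlyConsistent φ P₀ κX κY FX FY g h)
    (hgh : Tendsto (fun n : ℕ => √(n : ℝ) * g n * h n) atTop (𝓝 0))
    {P : ℕ → ProbabilityMeasure (Obs d)} (hP : ∀ n, P n ∈ P₀ ∩ condIndepDistributions d)
    (t : EuclideanSpace ℝ (Fin q × Fin q)) :
    VanishesInProb (fun n => sampleLaw (P n) n) fun n w =>
      inner ℝ (√(n : ℝ) • rhoHat φ FX FY n w) t - (√(n : ℝ))⁻¹ * ∑ i, bilinearScore φ t
        (condCDF (κX (P n)) (obsX (w i)) (obsZ (w i)),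
          condCDF (κY (P n)) (obsY (w i)) (obsZ (w i))) := by
  obtain ⟨C, hC0, hC, -⟩ := hφ.exists_bound
  have hA := fun k => hφ.arrayBigO_rankError (V := obsX)
    (fun P hP => ae_forall_measure_singleton_eq_zero (hP₀ hP) measurePreserving_obsZ_obsX (hκX P hP))
    hcons.inner_X (fun n => (hP n).1) k
  have hB := fun l => hφ.arrayBigO_rankError (V := obsY)
    (fun P hP => ae_forall_measure_singleton_eq_zero (hP₀ hP) measurePreserving_obsZ_obsY (hκY P hP))
    hcons.inner_Y (fun n => (hP n).1) l
  have hcrossX : ∀ k l, VanishesInProb (fun n => sampleLaw (P n) n) fun n w =>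
      (√(n : ℝ))⁻¹ * ∑ i, rankError (φ k) FX (κX (P n)) n (fun i => (obsX (w i), obsZ (w i))) i *
        φ l (condCDF (κY (P n)) (obsY (w i)) (obsZ (w i))) := fun k l =>
    ArrayBigO.vanishesInProb_cross (ν := fun n => (P n : Measure (Obs d))) measurable_obsX_obsZ
      (ψ := fun n w => φ l (condCDF (κY (P n)) (obsY w) (obsZ w)))
      (fun n => (hφ.continuous l).measurable.comp (measurable_ranks (κX (P n)) (κY (P n))).snd)
      (fun n w => hC l _)
      (fun n => hφ.integral_mul_rankY_eq_zero (hP n).2 (hκX _ (hP n).1) (hκY _ (hP n).1) l)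
      (D := fun n => rankError (φ k) FX (κX (P n)) n)
      (fun n i => measurable_rankError (hφ.continuous k) FX _ i)
      (fun n s i => abs_rankError_le (hC k) FX _ s i) (hA k) hcons.g_tendsto
  have hcrossY : ∀ k l, VanishesInProb (fun n => sampleLaw (P n) n) fun n w =>
      (√(n : ℝ))⁻¹ * ∑ i, rankError (φ l) FY (κY (P n)) n (fun i => (obsY (w i), obsZ (w i))) i *
        φ k (condCDF (κX (P n)) (obsX (w i)) (obsZ (w i))) := fun k l =>
    ArrayBigO.vanishesInProb_cross (ν := fun n => (P n : Measure (Obs d))) measurable_obsY_obsZ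
      (ψ := fun n w => φ k (condCDF (κX (P n)) (obsX w) (obsZ w)))
      (fun n => (hφ.continuous k).measurable.comp (measurable_ranks (κX (P n)) (κY (P n))).fst)
      (fun n w => hC k _)
      (fun n => hφ.integral_mul_rankX_eq_zero (hP n).2 (hκX _ (hP n).1) (hκY _ (hP n).1) k)
      (D := fun n => rankError (φ l) FY (κY (P n)) n)
      (fun n i => measurable_rankError (hφ.continuous l) FY _ i)
      (fun n s i => abs_rankError_le (hC l) FY _ s i) (hB l) hcons.h_tendsto
  -- Now âb̂ - ab = (â - a) b + (b̂ - b) a + (â - a)(b̂ - b): the true ranks are needed in the cross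
  -- terms for orthogonality, which leaves the product of errors to the rate condition.
  have hsum := VanishesInProb.sum Finset.univ fun (kl : Fin q × Fin q) _ =>
    (((hcrossX kl.1 kl.2).add (hcrossY kl.1 kl.2)).add
      ((hA kl.1).vanishesInProb_sum_mul (hB kl.2) hgh)).const_mul (t kl)
  refine hsum.mono fun n w => le_of_eq (congrArg _ ?_)
  -- This also holds at n = 0, where both sides are 0 by convention.
  have hsq : √(n : ℝ) * (1 / (n : ℝ)) = (√(n : ℝ))⁻¹ := by
    rw [mul_one_div, Real.sqrt_div_self]
  have hinner : inner ℝ (√(n : ℝ) • rhoHat φ FX FY n w) t = ∑ kl : Fin q × Fin q, t kl *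
      ((√(n : ℝ))⁻¹ * ∑ i, φ kl.1 (estX FX n w (obsX (w i)) (obsZ (w i))) *
        φ kl.2 (estY FY n w (obsY (w i)) (obsZ (w i)))) := by
    rw [PiLp.inner_apply]
    refine Finset.sum_congr rfl fun kl _ => ?_
    rw [← hsq]
    simp [rhoHat, mul_assoc]
  simp only [bilinearScore]
  rw [hinner, Finset.sum_comm, Finset.mul_sum, ← Finset.sum_sub_distrib]
  refine Finset.sum_congr rfl fun kl _ => ?_
  rw [← Finset.mul_sum, mul_left_comm _ (t kl), ← mul_sub, ← mul_sub, ← mul_add, ← mul_add,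
    ← Finset.sum_sub_distrib, ← Finset.sum_add_distrib, ← Finset.sum_add_distrib]
  refine congrArg _ (congrArg _ (Finset.sum_congr rfl fun i _ => ?_))
  simp only [rankError, estX, estY]
  ring

theorem tendsto_charFun_rhoHat (hφ : Admissible φ) (hP₀ : P₀ ⊆ acDistributions d)
    (hκX : ∀ P ∈ P₀, IsCondDistrib P obsX (κX P)) (hκY : ∀ P ∈ P₀, IsCondDistrib P obsY (κY P))
    (hcons : UniformlyConsistent φ P₀ κX κY FX FY g h)
    (hgh : Tendsto (fun n : ℕ => √(n : ℝ) * g n * h n) atTop (𝓝 0))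
    {P : ℕ → ProbabilityMeasure (Obs d)} (hP : ∀ n, P n ∈ P₀ ∩ condIndepDistributions d)
    (t : EuclideanSpace ℝ (Fin q × Fin q)) :
    Tendsto (fun n => charFun ((sampleLaw (P n) n).map fun w => √(n : ℝ) • rhoHat φ FX FY n w) t)
      atTop (𝓝 (charFun (multivariateGaussian 0 (gram φ ⊗ₖ gram φ)) t)) := by
  have hb := (hφ.continuous_bilinearScore t).measurable
  have h1 := VanishesInProb.tendsto_charFun (X := fun n w => √(n : ℝ) • rhoHat φ FX FY n w)
    (T := fun n w => (√(n : ℝ))⁻¹ * ∑ i, bilinearScore φ t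
        (condCDF (κX (P n)) (obsX (w i)) (obsZ (w i)),
          condCDF (κY (P n)) (obsY (w i)) (obsZ (w i))))
    (fun n => (hφ.measurable_rhoHat FX FY n).const_smul (√(n : ℝ)))
    (fun n => (Finset.measurable_sum _ fun i _ => hb.comp
      ((measurable_ranks (κX (P n)) (κY (P n))).comp (measurable_pi_apply i))).const_mul _) t
    (vanishesInProb_inner_rhoHat_sub hφ hκX hκY hP₀ hcons hgh hP t)
  simp only [fun n => hφ.integral_cexp_bilinearScore (hP n).2 (hκX _ (hP n).1) (hκY _ (hP n).1) t n]
    at h1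
  have h2 := tendsto_integral_cexp_sum ((volume : Measure I).prod volume) hb
    (integrable_of_continuous_of_compactSpace ((hφ.continuous_bilinearScore t).pow 2))
    (hφ.integral_bilinearScore t)
  rw [hφ.integral_bilinearScore_sq] at h2
  have h3 := h1.add h2
  simp only [sub_add_cancel, zero_add] at h3
  rw [charFun_multivariateGaussian (hφ.posSemidef_gram.kronecker hφ.posSemidef_gram)]
  convert h3 using 3
  simp [neg_div]

end Main

end PartialCopula

theorem theorem4p12 {d q : ℕ} (φ : Fin q → I → ℝ) (hφ : Admissible φ)
    (P₀ : Set (ProbabilityMeasure (Obs d))) (hP₀ : P₀ ⊆ acDistributions d)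
    (κX κY : ProbabilityMeasure (Obs d) → Kernel (Cube d) I)
    [∀ P, IsMarkovKernel (κX P)] [∀ P, IsMarkovKernel (κY P)]
    (hκX : ∀ P ∈ P₀, IsCondDistrib P obsX (κX P))
    (hκY : ∀ P ∈ P₀, IsCondDistrib P obsY (κY P))
    (FX FY : CDFEstimator d) (g h : ℕ → ℝ)
    (hcons : UniformlyConsistent φ P₀ κX κY FX FY g h) :
    (Tendsto (fun n : ℕ => √(n : ℝ) * g n * h n) atTop (𝓝 0) →
      UniformTendstoInDistribution (P₀ ∩ condIndepDistributions d)
        (fun n w => √(n : ℝ) • rhoHat φ FX FY n w)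
        (multivariateGaussian 0 (gram φ ⊗ₖ gram φ))) ∧
    UniformTendstoInProbability P₀ (rhoHat φ FX FY) (fun P => rho φ P (κX P) (κY P)) := by
  refine ⟨fun hgh f => tendsto_biSup_of_forall_seq fun P hP => ?_,
    fun ε hε => tendsto_biSup_of_forall_seq fun P hP => ?_⟩
  · have hm : ∀ n, Measurable fun w : Fin n → Obs d => √(n : ℝ) • rhoHat φ FX FY n w := fun n =>
      (hφ.measurable_rhoHat FX FY n).const_smul (√(n : ℝ))
    -- Lévy's continuity theorem, along the given sequence of laws.
    have hlim := ProbabilityMeasure.tendsto_of_tendsto_charFun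
      (μ := fun n => ⟨(sampleLaw (P n) n).map fun w => √(n : ℝ) • rhoHat φ FX FY n w,
        Measure.isProbabilityMeasure_map (hm n).aemeasurable⟩)
      (μ₀ := ⟨multivariateGaussian 0 (gram φ ⊗ₖ gram φ), inferInstance⟩)
      (tendsto_charFun_rhoHat hφ hP₀ hκX hκY hcons hgh hP)
    have hf := ProbabilityMeasure.tendsto_iff_forall_integral_tendsto.1 hlim f
    simp only [ProbabilityMeasure.coe_mk] at hf
    simp only [fun n => integral_map (hm n).aemeasurable
      (f.continuous.measurable.aestronglyMeasurable)] at hf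
    have h0 := (hf.sub_const (∫ x, f x ∂(multivariateGaussian 0 (gram φ ⊗ₖ gram φ)))).abs
    rw [sub_self, abs_zero] at h0
    simpa using ENNReal.tendsto_ofReal h0
  · have hs := VanishesInProb.sum Finset.univ fun (kl : Fin q × Fin q) _ =>
      (vanishesInProb_rhoHat_sub_rho hφ hP₀ hκX hκY hcons hP kl).abs
    refine tendsto_measure_zero_of_subset (hs ε hε) fun n w hw => ?_
    refine lt_of_lt_of_le hw ((norm_le_sum_abs _).trans (le_abs_self _))
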